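/- **Notation.** Let $\langle\xi\rangle=(1+|\xi|^2)^{1/2}$ and $\widehat u(\xi)=\int_{\mathbb R^n} e^{-i\langle x,\xi\rangle}u(x)\,dx$, extended to $\mathcal S'(\mathbb R^n)$. - $\mathcal K_{pol}(\mathbb R^n)$ is the set of positive measurable functions $k$ on $\mathbb R^n$ for which there are constants $C,N>0$ with $k(\xi+\eta)\le C\langle\xi\rangle^{N}k(\eta)$ for all $\xi,\eta\in\mathbb R^n$. - $\mathcal K_a(\mathbb R^n)$ is the set of $k\in\mathcal K_{pol}(\mathbb R^n)$ for which there is a constant $C>0$ with $\frac1{k^2}*\frac1{k^2}\le\frac{C^2}{k^2}$ on $\mathbb R^n$. - For $k\in\mathcal K_{pol}(\mathbb R^n)$, $\mathcal B_k(\mathbb R^n)$ is the space of $u\in\mathcal S'(\mathbb R^n)$ such that $\widehat u$ is a function and $\|u\|_{\mathcal B_k}=\|k\widehat u\|_{L^2}<\infty$ (put $\|u\|_{\mathcal B_k}=\infty$ for all other $u \in \mathcal S'(\mathbb R^n)$). - $\mathcal B_k^\infty(\mathbb R^n)$ is the space of distributions $u\in\mathcal D'(\mathbb R^n)$ such that $\|u\|_{k,\infty,\chi}=\sup_{y\in\mathbb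 R^n}\|u\,\chi(\cdot-y)\|_{\mathcal B_k}<\infty$ for some $\chi\in C_0^\infty(\mathbb R^n)\setminus\{0\}$. It carries the norm $\|\cdot\|_{k,\infty,\chi}$ for any $\chi\in C_0^\infty(\mathbb R^n)\setminus\{0\}$; neither the space nor its topology depends on $\chi$. **Theorem (Wiener–Lévy for $\mathcal B_k^\infty$, weak form).** Let $\Omega\subset\mathbb C^d$ be open and let $\Phi:\Omega\to\mathbb C$ be holomorphic. Let $k\in\mathcal K_{pol}(\mathbb R^n)$ and $k'\in\mathcal K_a(\mathbb R^n)$ be such that $k'(\xi)/k(\xi)\to0$ as $\xi\to\infty$ and $1/k'\in L^2(\mathbb R^n)$. Then every element of $\mathcal B_k^\infty(\mathbb R^n)$ is given by a unique continuous function, with which it is identified, and the following holds. (a) If $u=(u_1,\dots,u_d)\in\mathcal B_k^\infty(\mathbb R^n)^d$ satisfies $\overline{u(\mathbb R^n)}\subset\Omega$, then $\Phi\circ u=\Phi(u)\in\mathcal B_{k'}^\infty(\mathbb R^n)$. (b) If $u,u_\varepsilon\in\mathcal B_k^\infty(\mathbb R^n)^d$ for $0<\varepsilon\le1$, $\overline{u(\mathbb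 R^n)}\subset\Omega$, and $u_\varepsilon\to u$ in $\mathcal B_{k'}^\infty(\mathbb R^n)^d$ as $\varepsilon\to0$, then there is $\varepsilon_0\in(0,1]$ such that $\overline{u_\varepsilon(\mathbb R^n)}\subset\Omega$ for every $0<\varepsilon\le\varepsilon_0$, and $\Phi(u_\varepsilon)\to\Phi(u)$ in $\mathcal B_{k'}^\infty(\mathbb R^n)$ as $\varepsilon\to0$. -/

import Mathlib

open MeasureTheory Filter Topology
open scoped Distributions SchwartzMap FourierTransform ENNReal ContDiff

noncomputable section

namespace WienerLevy

/-- The Euclidean space `ℝⁿ`. -/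
abbrev Sp (n : ℕ) : Type := EuclideanSpace ℝ (Fin n)

/-- The space `C₀^∞(ℝⁿ)` of complex-valued test functions with its usual inductive limit
topology. -/
abbrev Test (n : ℕ) : Type := 𝓓((⊤ : TopologicalSpace.Opens (Sp n)), ℂ)

/-- The space `𝒟'(ℝⁿ)` of complex distributions: continuous complex linear forms on
`C₀^∞(ℝⁿ)`. -/
abbrev Distr (n : ℕ) : Type := Test n →L[ℂ] ℂ

variable {n : ℕ}

/-! ### Weight functions -/

/-- `⟨ξ⟩ = (1 + |ξ|²)^{1/2}`. -/
def bracket (ξ : Sp n) : ℝ := Real.sqrt (1 + ‖ξ‖ ^ 2)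

/-- The class `𝒦_pol(ℝⁿ)` of weight functions of polynomial growth. -/
def IsKpol (k : Sp n → ℝ) : Prop :=
  Measurable k ∧ (∀ ξ, 0 < k ξ) ∧
    ∃ C N : ℝ, 0 < C ∧ 0 < N ∧ ∀ ξ η, k (ξ + η) ≤ C * bracket ξ ^ N * k η

/-- The class `𝒦_a(ℝⁿ)`: weights of polynomial growth such that
`(1/k²) * (1/k²) ≤ C²/k²` pointwise for some constant `C`. The convolution of nonnegative
functions is written as a Lebesgue integral with values in `[0, ∞]`, so that its finiteness
is part of the condition. -/
def IsKa (k : Sp n → ℝ) : Prop :=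
  IsKpol k ∧ ∃ C : ℝ, 0 < C ∧ ∀ ξ,
    ∫⁻ η, ENNReal.ofReal (1 / k η ^ 2) * ENNReal.ofReal (1 / k (ξ - η) ^ 2) ≤
      ENNReal.ofReal (C ^ 2 / k ξ ^ 2)

/-! ### The Fourier transformation, normalized as `û(ξ) = ∫ e^{-i⟨x,ξ⟩} u(x) dx` -/

/-- The dilation `x ↦ (2π)⁻¹ x`. -/
def dilation (n : ℕ) : Sp n ≃L[ℝ] Sp n :=
  ContinuousLinearEquiv.smulLeft (Units.mk0 ((2 * Real.pi)⁻¹ : ℝ) (by positivity))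

/-- The Fourier transform of a Schwartz function without `2π` in the exponent, obtained from
the transform `𝓕` with exponent `-2πi⟨x,ξ⟩` by a dilation; see `fourierS_apply`. -/
def fourierS (φ : 𝓢(Sp n, ℂ)) : 𝓢(Sp n, ℂ) :=
  SchwartzMap.compCLMOfContinuousLinearEquiv ℂ (dilation n) (𝓕 φ)

theorem fourierS_apply (φ : 𝓢(Sp n, ℂ)) (ξ : Sp n) :
    fourierS φ ξ = ∫ x, Complex.exp (-(Complex.I * (inner ℝ x ξ : ℝ))) * φ x := by
  change (𝓕 φ : 𝓢(Sp n, ℂ)) (((2 * Real.pi)⁻¹ : ℝ) • ξ) = _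
  rw [SchwartzMap.fourier_coe, Real.fourier_eq']
  refine integral_congr_ae (Eventually.of_forall fun x => ?_)
  simp only [smul_eq_mul, inner_smul_right]
  congr 2
  have h : (Real.pi : ℂ) ≠ 0 := by exact_mod_cast Real.pi_ne_zero
  push_cast
  field_simp

/-- `û = g`: the Fourier transform of the tempered distribution `T` is the function `g`, that
is `⟨û, φ⟩ = ⟨T, φ̂⟩ = ∫ g φ` for all Schwartz functions `φ`. Such a `g` is locally integrable
and unique up to equality almost everywhere. -/
def HasFourier (T : 𝓢'(Sp n, ℂ)) (g : Sp n → ℂ) : Prop :=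
  AEStronglyMeasurable g volume ∧
    ∀ φ : 𝓢(Sp n, ℂ), Integrable (fun ξ => g ξ * φ ξ) volume ∧
      T (fourierS φ) = ∫ ξ, g ξ * φ ξ

/-- The norm `‖T‖_{ℬ_k} = ‖k T̂‖_{L²}` with values in `[0, ∞]`; it is `∞` if `T̂` is not a
function or if `k T̂` is not in `L²`. So `ℬ_k = B_{2,k}` is the set of all `T ∈ 𝒮'` for which it
is finite. For a weight `k` of polynomial growth, `k g ∈ L²` implies that `g φ` is integrable for
every Schwartz function `φ`. The infimum is over a set with at most one value. -/
def bNorm (k : Sp n → ℝ) (T : 𝓢'(Sp n, ℂ)) : ℝ≥0∞ :=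
  ⨅ (g : Sp n → ℂ) (_ : HasFourier T g), eLpNorm (fun ξ => (k ξ : ℂ) * g ξ) 2 volume

/-! ### Products of distributions and test functions -/

/-- The translate `τ_y χ = χ(· - y)`. -/
def translate (y : Sp n) (χ : Test n) : Test n where
  toFun x := χ (x - y)
  contDiff' := χ.contDiff.comp (contDiff_id.sub contDiff_const)
  hasCompactSupport' := χ.hasCompactSupport.comp_homeomorph (Homeomorph.subRight y)
  tsupport_subset' := fun _ _ => trivial

/-- The compact set `supp χ`. -/
def suppC (χ : Test n) : TopologicalSpace.Compacts (Sp n) := ⟨tsupport χ, χ.hasCompactSupport⟩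

theorem Test.hasTemperateGrowth (χ : Test n) : Function.HasTemperateGrowth (χ : Sp n → ℂ) :=
  χ.hasCompactSupport.hasTemperateGrowth χ.contDiff

/-- `φ ↦ χ φ` as a linear map from `𝒮` to the smooth functions supported in `supp χ`. -/
def mulSupportedLM (χ : Test n) : 𝓢(Sp n, ℂ) →ₗ[ℂ] 𝓓_{suppC χ}(Sp n, ℂ) where
  toFun φ := ContDiffMapSupportedIn.of_support_subset (f := fun x => χ x * φ x)
    (χ.contDiff.mul (φ.smooth ⊤))
    ((Function.support_mul_subset_left _ _).trans subset_closure)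
  map_add' φ ψ := by
    ext x
    exact mul_add (χ x) (φ x) (ψ x)
  map_smul' c φ := by
    ext x
    exact mul_left_comm (χ x) c (φ x)

theorem continuous_mulSupportedLM (χ : Test n) : Continuous (mulSupportedLM χ) := by
  refine WithSeminorms.continuous_of_continuous_comp
    (ContDiffMapSupportedIn.withSeminorms ℂ (Sp n) ℂ ⊤ (suppC χ)) _ fun i => ?_
  let q : Seminorm ℂ 𝓢(Sp n, ℂ) := (SchwartzMap.seminorm ℂ 0 i).comp
    (SchwartzMap.smulLeftCLM ℂ (χ : Sp n → ℂ)).toLinearMap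
  have hcont : Continuous q :=
    ((schwartz_withSeminorms ℂ (Sp n) ℂ).continuous_seminorm (0, i)).comp
      (SchwartzMap.smulLeftCLM ℂ (χ : Sp n → ℂ)).continuous
  refine Seminorm.continuous_of_le (q := q) hcont fun φ => ?_
  refine (ContDiffMapSupportedIn.seminorm_top_le_iff ℂ (apply_nonneg _ _) i _).2 fun x _ => ?_
  have hfun : ((mulSupportedLM χ φ : 𝓓_{suppC χ}(Sp n, ℂ)) : Sp n → ℂ) =
      (SchwartzMap.smulLeftCLM ℂ (χ : Sp n → ℂ) φ : 𝓢(Sp n, ℂ)) := by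
    funext x
    exact (SchwartzMap.smulLeftCLM_apply_apply (Test.hasTemperateGrowth χ) φ x).symm
  rw [hfun]
  exact SchwartzMap.norm_iteratedFDeriv_le_seminorm ℂ _ i x

/-- `φ ↦ χ φ` as a continuous linear map from `𝒮(ℝⁿ)` to `C₀^∞(ℝⁿ)`. -/
def mulTest (χ : Test n) : 𝓢(Sp n, ℂ) →L[ℂ] Test n :=
  (TestFunction.ofSupportedInCLM ℂ (Ω := ⊤) (K := suppC χ) (fun _ _ => trivial)).comp
    ⟨mulSupportedLM χ, continuous_mulSupportedLM χ⟩

theorem mulTest_apply (χ : Test n) (φ : 𝓢(Sp n, ℂ)) (x : Sp n) :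
    mulTest χ φ x = χ x * φ x := rfl

/-- The product `χ u` of a distribution and a test function, as a (compactly supported) tempered
distribution: `⟨χ u, φ⟩ = ⟨u, χ φ⟩`. -/
def cutoff (χ : Test n) (u : Distr n) : 𝓢'(Sp n, ℂ) :=
  ContinuousLinearMap.toPointwiseConvergenceCLM ℂ (RingHom.id ℂ) _ _ (u.comp (mulTest χ))

theorem cutoff_apply (χ : Test n) (u : Distr n) (φ : 𝓢(Sp n, ℂ)) :
    cutoff χ u φ = u (mulTest χ φ) := rfl

/-! ### The spaces `ℬ_k^∞` -/

/-- `‖u‖_{k,∞,χ} = sup_y ‖u τ_y χ‖_{ℬ_k}`, with values in `[0, ∞]`. -/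
def ulNorm (k : Sp n → ℝ) (χ : Test n) (u : Distr n) : ℝ≥0∞ :=
  ⨆ y : Sp n, bNorm k (cutoff (translate y χ) u)

/-- `u ∈ ℬ_k^∞(ℝⁿ)`. -/
def MemBInf (k : Sp n → ℝ) (u : Distr n) : Prop :=
  ∃ χ : Test n, χ ≠ 0 ∧ ulNorm k χ u < ⊤

/-- The distribution `φ ↦ ∫ φ f` defined by a locally integrable function `f`. -/
def ofFun (f : Sp n → ℂ) : Distr n :=
  TestFunction.integralAgainstBilinCLM (ContinuousLinearMap.mul ℂ ℂ) volume f

/-- The `d`-tuple of distributions `u` is given by the continuous function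
`f = (f₁, …, f_d) : ℝⁿ → ℂ^d`. -/
def IsContRep {d : ℕ} (u : Fin d → Distr n) (f : Sp n → Fin d → ℂ) : Prop :=
  Continuous f ∧ ∀ j, u j = ofFun fun x => f x j

end WienerLevy

end

open WienerLevy

/-! `FourierRep k f M` says that f(x) = ∫ e^{i⟨x,ξ⟩} a(ξ) dξ with ‖k a‖_{L²} ≤ M. Up to a power of
2π this is the norm of ℬ_k, so f lies in ℬ_k^∞ when the functions χ(· - y) f satisfy it with one M
for all y. Since k' ≤ c k, both 1/k' and 1/k are in L²; hence a is integrable, the local pieces are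
continuous functions bounded by `invNorm k * M`, and they glue to one continuous function
(`exists_continuous_eq_ofFun`). The condition on (1/k'²) * (1/k'²) makes the space with weight k' an
algebra, by Cauchy–Schwarz in the convolution of coefficients (`FourierRep.mul`).

The heart is `exists_rep_comp`. Take χ₁ equal to 1 where χ ≠ 0, and cut off the frequencies of χ₁(·
- y) f at a radius independent of y. The low part v is smooth, with bounds on its derivatives
independent of y; the high part is small in the weight k', because k'/k → 0 (`exists_truncation`).
For g locally close to f in the weight k', put h = χ₁(· - y) g - v. Cauchy's formula on the polydisc
of radius r about v(x) writes χ(x - y) Φ(g(x)) as the mean over θ of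

χ(x - y) Φ(v(x) + r e^{iθ}) ∏_j (1 - h_j(x) / (r e^{iθ_j}))⁻¹.

The first factor is smooth with compact support, so it lies in every weighted space with a uniform
bound (`exists_rep_of_contDiff`). The others are Neumann series in the algebra, because h is small.
Telescoping the product shows that Φ(g) - Φ(g') is bounded by a constant times g - g'. The centre v
is built from f alone, so u_ε only has to be close to u in the weaker space. Assertion (a) is the
case g = f, and (b) is the difference estimate.

The averages over θ and the limits of the Neumann series stay in the space because it is a
reproducing kernel Hilbert space: membership with norm at most M is a family of inequalities, each
involving finitely many values of f. -/

noncomputable section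

namespace WienerLevy

/-! ### Holomorphic functions of several variables -/

section Holomorphic

open Metric Complex

/-- The Cauchy integral formula on a polydisc. -/
theorem torusIntegral_prod_sub_inv_mul {d : ℕ} {r : ℝ} (hr : 0 < r) (c w : Fin d → ℂ)
    (hw : ∀ j, w j ∈ ball (c j) r) (F : (Fin d → ℂ) → ℂ)
    (hF : DifferentiableOn ℂ F (closedBall c r)) :
    torusIntegral (fun ζ => (∏ j, (ζ j - w j)⁻¹) * F ζ) c (fun _ => r) =
      (2 * Real.pi * I) ^ d * F w := by
  induction d with
  | zero =>
    rw [torusIntegral_dim0]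
    simp [Subsingleton.elim c w]
  | succ d ih =>
    have hne : ∀ (θ : Fin (d + 1) → ℝ) j, torusMap c (fun _ => r) θ j - w j ≠ 0 := by
      intro θ j h0
      have h1 : w j = c j + r * exp (θ j * I) := by
        rw [sub_eq_zero] at h0
        exact h0.symm
      have h2 := hw j
      rw [h1, mem_ball, dist_eq_norm] at h2
      simp [Complex.norm_exp_ofReal_mul_I, abs_of_pos hr] at h2
    have hmap : ∀ θ : Fin (d + 1) → ℝ, torusMap c (fun _ => r) θ ∈ closedBall c r := by
      intro θ
      rw [mem_closedBall, dist_pi_le_iff hr.le]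
      intro j
      simp [torusMap, dist_eq_norm, Complex.norm_exp_ofReal_mul_I, abs_of_pos hr]
    have hcm : Continuous (torusMap c (fun _ => r)) := by
      unfold torusMap; fun_prop
    have hint : TorusIntegrable (fun ζ => (∏ j, (ζ j - w j)⁻¹) * F ζ) c (fun _ => r) := by
      refine Continuous.integrableOn_Icc ?_
      refine Continuous.mul ?_ (hF.continuousOn.comp_continuous hcm hmap)
      exact continuous_finsetProd _ fun j _ =>
        Continuous.inv₀ (((continuous_apply j).comp hcm).sub continuous_const) (fun θ => hne θ j)
    -- Fubini splits off the first circle. With the first coordinate fixed on it, the inductive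
    -- hypothesis evaluates the remaining integral; the one-variable Cauchy formula then does the
    -- outer one.
    rw [torusIntegral_succ hint]
    have hinner : ∀ x ∈ sphere (c 0) r,
        torusIntegral (fun y : Fin d → ℂ =>
          (∏ j, ((Fin.cons x y : Fin (d + 1) → ℂ) j - w j)⁻¹) * F (Fin.cons x y))
          (c ∘ Fin.succ) ((fun _ => r) ∘ Fin.succ) =
        (x - w 0)⁻¹ • ((2 * Real.pi * I) ^ d * F (Fin.cons x (w ∘ Fin.succ))) := by
      intro x hx
      have := ih (c ∘ Fin.succ) (w ∘ Fin.succ) (fun j => hw j.succ) (fun y => F (Fin.cons x y)) ?_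
      · rw [← this, smul_eq_mul, ← torusIntegral_const_mul]
        congr 1
        funext y
        rw [Fin.prod_univ_succ]
        simp [mul_assoc]
      · refine hF.comp (Differentiable.differentiableOn ?_) fun y hy => ?_
        · refine differentiable_pi.2 fun j => ?_
          refine Fin.cases ?_ (fun j => ?_) j
          · simp
          · simpa using differentiable_apply (𝕜 := ℂ) j
        · rw [mem_closedBall, dist_pi_le_iff hr.le] at hy ⊢
          refine Fin.cases ?_ (fun j => ?_)
          · simpa using (mem_sphere.1 hx).le
          · simpa using hy j
    rw [circleIntegral.integral_congr hr.le hinner,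
      DifferentiableOn.circleIntegral_sub_inv_smul _ (hw 0), smul_eq_mul, pow_succ']
    · have : (Fin.cons (w 0) (w ∘ Fin.succ) : Fin (d + 1) → ℂ) = w := Fin.cons_self_tail w
      rw [this]; ring
    · refine DifferentiableOn.const_mul ?_ _
      refine hF.comp (Differentiable.differentiableOn ?_) fun x hx => ?_
      · refine differentiable_pi.2 fun j => ?_
        refine Fin.cases ?_ (fun j => ?_) j
        · simp
        · simp
      · rw [mem_closedBall] at hx
        rw [mem_closedBall, dist_pi_le_iff hr.le]
        refine Fin.cases ?_ (fun j => ?_)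
        · simpa using hx
        · simpa using (mem_ball.1 (hw j.succ)).le

/-- The Cauchy integral formula on a polydisc, written as a mean value. -/
theorem cauchy_polydisc {d : ℕ} {r : ℝ} (hr : 0 < r) (c h : Fin d → ℂ)
    (hh : ∀ j, ‖h j‖ < r) (F : (Fin d → ℂ) → ℂ) (hF : DifferentiableOn ℂ F (closedBall c r)) :
    F (c + h) = ∫ θ in Set.Icc (0 : Fin d → ℝ) (fun _ => 2 * Real.pi),
      ((2 * Real.pi : ℂ) ^ d)⁻¹ * (F (torusMap c (fun _ => r) θ) *
        ∏ j, (1 - (r * exp (θ j * I))⁻¹ * h j)⁻¹) := by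
  have key := torusIntegral_prod_sub_inv_mul hr c (c + h)
    (fun j => by simpa [dist_eq_norm] using hh j) F hF
  have hpi : (2 * Real.pi * I : ℂ) ^ d ≠ 0 := by
    apply pow_ne_zero; simp [Real.pi_ne_zero]
  rw [eq_comm, ← eq_inv_mul_iff_mul_eq₀ hpi] at key
  rw [key, torusIntegral, ← integral_const_mul]
  refine integral_congr_ae (Eventually.of_forall fun θ => ?_)
  -- The Jacobian factor r e^{iθ_j} i cancels the leading factor of the Cauchy kernel, since r
  -- e^{iθ_j} - h_j = r e^{iθ_j} (1 - h_j / (r e^{iθ_j})).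
  have hI : ∏ j, ((r : ℂ) * exp (θ j * I) * I) * (torusMap c (fun _ => r) θ j - (c + h) j)⁻¹ =
      ∏ j, (I * (1 - (r * exp (θ j * I))⁻¹ * h j)⁻¹) := by
    refine Finset.prod_congr rfl fun j _ => ?_
    have h1 : (r : ℂ) * exp (θ j * I) ≠ 0 :=
      mul_ne_zero (by exact_mod_cast hr.ne') (exp_ne_zero _)
    have h2 : torusMap c (fun _ => r) θ j - (c + h) j =
        (r * exp (θ j * I)) * (1 - (r * exp (θ j * I))⁻¹ * h j) := by
      rw [mul_sub, mul_inv_cancel_left₀ h1]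
      simp [torusMap]
    rw [h2, mul_inv, mul_comm _ I, mul_assoc, mul_inv_cancel_left₀ h1]
  simp only [smul_eq_mul]
  rw [← mul_assoc (∏ j, _) (∏ j, _), ← Finset.prod_mul_distrib, hI, Finset.prod_mul_distrib]
  simp only [Finset.prod_const, Finset.card_univ, Fintype.card_fin, mul_pow]
  have hId : (I : ℂ) ^ d ≠ 0 := pow_ne_zero _ I_ne_zero
  generalize (∏ j, (1 - (r * exp (θ j * I))⁻¹ * h j)⁻¹ : ℂ) = P
  field_simp

/-! ### Smoothness of holomorphic functions in several variables -/

variable {E : Type*} [NormedAddCommGroup E] [NormedSpace ℂ E] [FiniteDimensional ℂ E]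

/-- Directional derivatives of a holomorphic function are holomorphic. -/
theorem differentiableOn_fderiv_apply {F : E → ℂ} {U : Set E} (hU : IsOpen U)
    (hF : DifferentiableOn ℂ F U) (e : E) :
    DifferentiableOn ℂ (fun w => fderiv ℂ F w e) U := by
  have : ProperSpace E := FiniteDimensional.proper ℂ E
  let _ : MeasurableSpace E := borel E
  have : BorelSpace E := ⟨rfl⟩
  intro w₀ hw₀
  refine DifferentiableAt.differentiableWithinAt ?_
  -- Three radii: F is bounded on the ball of radius 3ρ, hence by Cauchy's estimate `fderiv ℂ F` on
  -- that of radius 2ρ, and the integral formula for the directional derivative is used on that of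
  -- radius ρ.
  obtain ⟨ρ, hρ, hball⟩ : ∃ ρ > 0, closedBall w₀ (3 * ρ) ⊆ U := by
    obtain ⟨δ, hδ, h⟩ := nhds_basis_closedBall.mem_iff.1 (hU.mem_nhds hw₀)
    exact ⟨δ / 3, by positivity, by simpa [mul_div_cancel₀] using h⟩
  obtain ⟨C, hC⟩ := (isCompact_closedBall w₀ (3 * ρ)).exists_bound_of_continuousOn
    (hF.continuousOn.mono hball)
  have hdiff : ∀ w ∈ closedBall w₀ (3 * ρ), DifferentiableAt ℂ F w := fun w hw =>
    hF.differentiableAt (hU.mem_nhds (hball hw))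
  have hC0 : 0 ≤ C := (norm_nonneg _).trans (hC w₀ (mem_closedBall_self (by positivity)))
  have hline : ∀ (v : E) (s t : ℝ), ‖v‖ * s ≤ ρ → t ≤ 2 * ρ → ∀ w ∈ closedBall w₀ t, ∀ z : ℂ,
      ‖z‖ ≤ s → w + z • v ∈ closedBall w₀ (3 * ρ) := by
    intro v s t hs ht w hw z hz
    rw [mem_closedBall, dist_eq_norm] at hw ⊢
    calc ‖w + z • v - w₀‖ = ‖(w - w₀) + z • v‖ := by congr 1; abel
      _ ≤ ‖w - w₀‖ + ‖z‖ * ‖v‖ := (norm_add_le _ _).trans (by rw [norm_smul])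
      _ ≤ 2 * ρ + ρ := add_le_add (hw.trans ht)
          ((mul_le_mul_of_nonneg_right hz (norm_nonneg _)).trans (by rwa [mul_comm]))
      _ = 3 * ρ := by ring
  have hd1 : ∀ (v : E) (s : ℝ), ‖v‖ * s ≤ ρ → ∀ w ∈ closedBall w₀ (2 * ρ),
      DifferentiableOn ℂ (fun z : ℂ => F (w + z • v)) (closedBall 0 s) := by
    intro v s hs w hw z hz
    refine DifferentiableAt.differentiableWithinAt ?_
    exact DifferentiableAt.comp z (hdiff _ (hline v s _ hs le_rfl w hw z (by simpa using hz)))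
      (by fun_prop)
  have hderiv : ∀ (v : E), ∀ w ∈ closedBall w₀ (2 * ρ),
      deriv (fun z : ℂ => F (w + z • v)) 0 = fderiv ℂ F w v := by
    intro v w hw
    have h1 : HasDerivAt (fun z : ℂ => w + z • v) v 0 := by
      simpa using ((hasDerivAt_id (0 : ℂ)).smul_const v).const_add w
    have h2 : HasFDerivAt F (fderiv ℂ F w) (w + (0 : ℂ) • v) := by
      simpa using (hdiff w (closedBall_subset_closedBall (by linarith) hw)).hasFDerivAt
    exact (h2.comp_hasDerivAt 0 h1).deriv
  have hbound : ∀ w ∈ closedBall w₀ (2 * ρ), ‖fderiv ℂ F w‖ ≤ C / ρ := by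
    intro w hw
    refine ContinuousLinearMap.opNorm_le_of_unit_norm (by positivity) fun v hv => ?_
    rw [← hderiv v w hw]
    refine Complex.norm_deriv_le_of_forall_mem_sphere_norm_le hρ
      ((hd1 v ρ (by simp [hv]) w hw).mono closure_ball_subset_closedBall).diffContOnCl ?_
    intro z hz
    exact hC _ (hline v ρ _ (by simp [hv]) le_rfl w hw z (by simpa using (mem_sphere.1 hz).le))
  obtain ⟨s, hs, hes⟩ : ∃ s > 0, ‖e‖ * s ≤ ρ := by
    refine ⟨ρ / (‖e‖ + 1), by positivity, ?_⟩
    rw [← mul_div_assoc, div_le_iff₀ (by positivity)]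
    nlinarith [norm_nonneg e]
  let G : E → ℝ → ℂ := fun w t =>
    (deriv (circleMap 0 s) t * (1 / (circleMap 0 s t - 0) ^ 2)) • F (w + circleMap 0 s t • e)
  have hcirc : ∀ t, ‖circleMap 0 s t‖ = s := fun t => by simp [abs_of_pos hs]
  -- Cauchy's formula for the derivative of z ↦ F(w + z e) at 0. In this form w enters only through
  -- values of F, so the integral can be differentiated in w under the integral sign.
  have hrep : ∀ w ∈ closedBall w₀ ρ,
      fderiv ℂ F w e = (2 * Real.pi * I)⁻¹ * ∫ t in (0)..(2 * Real.pi), G w t := by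
    intro w hw
    have hw2 : w ∈ closedBall w₀ (2 * ρ) := closedBall_subset_closedBall (by linarith) hw
    have := DifferentiableOn.deriv_eq_smul_circleIntegral hs (hd1 e s hes w hw2)
    rw [hderiv e w hw2, circleIntegral, smul_eq_mul] at this
    rw [eq_inv_mul_iff_mul_eq₀ (by simp [Real.pi_ne_zero]), ← this]
    simp only [G, smul_eq_mul, mul_assoc]
  have hmem : ∀ w ∈ closedBall w₀ ρ, ∀ t, w + circleMap 0 s t • e ∈ closedBall w₀ (2 * ρ) := by
    intro w hw t
    rw [mem_closedBall, dist_eq_norm] at hw ⊢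
    calc ‖w + circleMap 0 s t • e - w₀‖ = ‖(w - w₀) + circleMap 0 s t • e‖ := by congr 1; abel
      _ ≤ ‖w - w₀‖ + s * ‖e‖ := (norm_add_le _ _).trans (by rw [norm_smul, hcirc])
      _ ≤ 2 * ρ := by rw [mul_comm s]; linarith
  have hGc : ∀ w ∈ closedBall w₀ ρ, Continuous (G w) := by
    intro w hw
    change Continuous fun t => (deriv (circleMap 0 s) t * (1 / (circleMap 0 s t - 0) ^ 2)) •
      F (w + circleMap 0 s t • e)
    refine Continuous.fun_smul ?_ ?_
    · simp only [deriv_circleMap, sub_zero]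
      refine Continuous.mul (by fun_prop) (continuous_const.div (by fun_prop) fun t => ?_)
      exact pow_ne_zero _ (norm_ne_zero_iff.1 (by rw [hcirc]; exact hs.ne'))
    · refine (hF.continuousOn.mono hball).comp_continuous (by fun_prop) fun t => ?_
      exact closedBall_subset_closedBall (by linarith) (hmem w hw t)
  let G' : E → ℝ → E →L[ℂ] ℂ := fun w t =>
    (deriv (circleMap 0 s) t * (1 / (circleMap 0 s t - 0) ^ 2)) •
      fderiv ℂ F (w + circleMap 0 s t • e)
  have hD : HasFDerivAt (fun w => ∫ t in Set.Ioc 0 (2 * Real.pi), G w t)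
      (∫ t in Set.Ioc 0 (2 * Real.pi), G' w₀ t) w₀ := by
    refine hasFDerivAt_integral_of_dominated_of_fderiv_le (s := ball w₀ ρ)
      (bound := fun _ => s⁻¹ * (C / ρ)) (ball_mem_nhds _ hρ) ?_ ?_ ?_ ?_ ?_ ?_
    · filter_upwards [ball_mem_nhds w₀ hρ] with w hw
      exact (hGc w (ball_subset_closedBall hw)).aestronglyMeasurable
    · exact (hGc w₀ (mem_closedBall_self hρ.le)).integrableOn_Ioc
    · change AEStronglyMeasurable (fun t =>
        (deriv (circleMap 0 s) t * (1 / (circleMap 0 s t - 0) ^ 2)) •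
          fderiv ℂ F (w₀ + circleMap 0 s t • e)) _
      refine AEStronglyMeasurable.fun_smul ?_ ?_
      · refine Measurable.aestronglyMeasurable ?_
        simp only [deriv_circleMap]
        fun_prop
      -- Continuity of the derivative is not known at this stage; its measurability is enough.
      · exact ((measurable_fderiv ℂ F).comp
          (by fun_prop : Measurable fun t : ℝ => w₀ + circleMap 0 s t • e)).aestronglyMeasurable
    · refine Eventually.of_forall fun t w hw => ?_
      have h1 : ‖deriv (circleMap 0 s) t * (1 / (circleMap 0 s t - 0) ^ 2)‖ = s⁻¹ := by
        simp only [deriv_circleMap, sub_zero, norm_mul, norm_div, norm_pow, hcirc]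
        simp
        field_simp
      simp only [G']
      rw [norm_smul, h1]
      exact mul_le_mul_of_nonneg_left (hbound _ (hmem w (ball_subset_closedBall hw) t))
        (by positivity)
    · exact integrable_const _
    · refine Eventually.of_forall fun t w hw => ?_
      have h1 := (hdiff _ (closedBall_subset_closedBall (by linarith)
        (hmem w (ball_subset_closedBall hw) t))).hasFDerivAt
      have h2 : HasFDerivAt (fun w : E => w + circleMap 0 s t • e) (ContinuousLinearMap.id ℂ E) w :=
        (hasFDerivAt_id w).add_const _
      exact (h1.comp w h2).const_smul (deriv (circleMap 0 s) t * (1 / (circleMap 0 s t - 0) ^ 2))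
  have hfin := (hD.const_mul (2 * Real.pi * I)⁻¹).differentiableAt
  refine hfin.congr_of_eventuallyEq ?_
  filter_upwards [ball_mem_nhds w₀ hρ] with w hw
  rw [hrep w (ball_subset_closedBall hw), intervalIntegral.integral_of_le (by positivity)]

/-- A holomorphic function of several variables is smooth. -/
theorem contDiffOn_of_differentiableOn {F : E → ℂ} {U : Set E} (hU : IsOpen U)
    (hF : DifferentiableOn ℂ F U) (m : ℕ) : ContDiffOn ℂ m F U := by
  induction m generalizing F with
  | zero => exact contDiffOn_zero.2 hF.continuousOn
  | succ m ih =>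
    push_cast
    rw [contDiffOn_succ_iff_fderiv_of_isOpen hU]
    refine ⟨hF, by simp, contDiffOn_clm_apply.2 fun e => ?_⟩
    exact ih (differentiableOn_fderiv_apply hU hF e)

end Holomorphic

/-! ### Functions in the range of a reproducing kernel Hilbert space -/

section Hilbert

variable {X H : Type*} [NormedAddCommGroup H] [InnerProductSpace ℂ H]

/-- A function `f` is of the form `x ↦ ⟪ψ x, β⟫` with `‖β‖ ≤ M` as soon as it satisfies the
corresponding inequality for all finite linear combinations. -/
theorem exists_inner_eq_of_forall_norm_le [CompleteSpace H] (ψ : X → H) (f : X → ℂ)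
    {M : ℝ} (hM : 0 ≤ M)
    (h : ∀ c : X →₀ ℂ, ‖Finsupp.linearCombination ℂ (fun x => starRingEnd ℂ (f x)) c‖ ≤
      M * ‖Finsupp.linearCombination ℂ ψ c‖) :
    ∃ β : H, ‖β‖ ≤ M ∧ ∀ x, f x = inner ℂ (ψ x) β := by
  let T : (X →₀ ℂ) →ₗ[ℂ] H := Finsupp.linearCombination ℂ ψ
  let F : (X →₀ ℂ) →ₗ[ℂ] ℂ := Finsupp.linearCombination ℂ (fun x => starRingEnd ℂ (f x))
  -- The inequality forces F to vanish on the kernel of T, so F ∘ S, with S a linear section of T,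
  -- is the functional that F induces on the range of T. Hahn–Banach extends it with norm at most M,
  -- and Riesz represents it by β.
  obtain ⟨S, hS⟩ := T.rangeRestrict.exists_rightInverse_of_surjective T.range_rangeRestrict
  let φ : T.range →ₗ[ℂ] ℂ := F ∘ₗ S
  have hTS : ∀ v : T.range, T (S v) = v := fun v => by
    have := LinearMap.congr_fun hS v
    exact congrArg Subtype.val this
  have hφ : ∀ v, ‖φ v‖ ≤ M * ‖v‖ := fun v => by
    have := h (S v)
    change ‖F (S v)‖ ≤ M * ‖T (S v)‖ at this
    rwa [hTS] at this
  obtain ⟨g, hg, hgn⟩ := exists_extension_norm_eq T.range (φ.mkContinuous M hφ)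
  refine ⟨(InnerProductSpace.toDual ℂ H).symm g, ?_, fun x => ?_⟩
  · rw [LinearIsometryEquiv.norm_map, hgn]
    exact φ.mkContinuous_norm_le hM hφ
  · let v : T.range := ⟨ψ x, Finsupp.single x 1, by simp [T]⟩
    have h1 : g (ψ x) = φ v := hg v
    have h2 : F (S v - Finsupp.single x 1) = 0 := by
      have := h (S v - Finsupp.single x 1)
      change ‖F (S v - Finsupp.single x 1)‖ ≤ M * ‖T (S v - Finsupp.single x 1)‖ at this
      rw [map_sub T, hTS] at this
      simpa [T, v] using this
    have h3 : φ v = starRingEnd ℂ (f x) := by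
      rw [map_sub, sub_eq_zero] at h2
      change F (S v) = _
      rw [h2]
      simp [F]
    rw [← inner_conj_symm, InnerProductSpace.toDual_symm_apply, h1, h3, Complex.conj_conj]

/-- The converse criterion: the left-hand combination is the inner product of β with the combination
of the vectors ψ x, so Cauchy–Schwarz applies. -/
theorem norm_linearCombination_le_of_inner_eq {ψ : X → H} {f : X → ℂ} {β : H}
    (h : ∀ x, f x = inner ℂ (ψ x) β) (c : X →₀ ℂ) :
    ‖Finsupp.linearCombination ℂ (fun x => starRingEnd ℂ (f x)) c‖ ≤
      ‖β‖ * ‖Finsupp.linearCombination ℂ ψ c‖ := by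
  have : Finsupp.linearCombination ℂ (fun x => starRingEnd ℂ (f x)) c =
      inner ℂ β (Finsupp.linearCombination ℂ ψ c) := by
    simp only [Finsupp.linearCombination_apply, Finsupp.sum, inner_sum, inner_smul_right,
      smul_eq_mul, h, inner_conj_symm]
  rw [this]
  exact norm_inner_le_norm _ _

end Hilbert

variable {n : ℕ}

/-! ### Weights and the spaces of functions `x ↦ ∫ e^{i⟨x,ξ⟩} a(ξ) dξ` with `k a ∈ L²` -/

/-- Positive measurable functions with reciprocal in `L²`. -/
structure IsL2Weight (k : Sp n → ℝ) : Prop where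
  measurable : Measurable k
  pos : ∀ ξ, 0 < k ξ
  memLp : MemLp (fun ξ => 1 / k ξ) 2 volume

/-- The character `e^{i⟨x,ξ⟩}`. -/
def expI (x ξ : Sp n) : ℂ := Complex.exp (Complex.I * (inner ℝ x ξ : ℝ))

@[simp] theorem norm_expI (x ξ : Sp n) : ‖expI x ξ‖ = 1 := by
  rw [expI, mul_comm, Complex.norm_exp_ofReal_mul_I]

@[fun_prop] theorem continuous_expI : Continuous fun p : Sp n × Sp n => expI p.1 p.2 := by
  unfold expI; fun_prop

@[fun_prop] theorem continuous_expI_right (x : Sp n) : Continuous (expI x) := by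
  unfold expI; fun_prop

@[fun_prop] theorem continuous_expI_left (ξ : Sp n) : Continuous fun x => expI x ξ := by
  unfold expI; fun_prop

theorem expI_add_right (x ξ η : Sp n) : expI x (ξ + η) = expI x ξ * expI x η := by
  rw [expI, expI, expI, ← Complex.exp_add, inner_add_right]; push_cast; ring_nf

theorem expI_add_left (x y ξ : Sp n) : expI (x + y) ξ = expI x ξ * expI y ξ := by
  rw [expI, expI, expI, ← Complex.exp_add, inner_add_left]; push_cast; ring_nf

/-- The function `x ↦ ∫ e^{i⟨x,ξ⟩} a(ξ) dξ`. -/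
def synth (a : Sp n → ℂ) (x : Sp n) : ℂ := ∫ ξ, expI x ξ * a ξ

theorem integrable_expI_mul {a : Sp n → ℂ} (ha : Integrable a) (x : Sp n) :
    Integrable fun ξ => expI x ξ * a ξ :=
  ha.bdd_mul (c := 1) (by fun_prop) (Eventually.of_forall fun ξ => by simp)

theorem norm_synth_le (a : Sp n → ℂ) (x : Sp n) : ‖synth a x‖ ≤ ∫ ξ, ‖a ξ‖ := by
  refine (norm_integral_le_integral_norm _).trans (le_of_eq ?_)
  simp

theorem continuous_synth {a : Sp n → ℂ} (ha : Integrable a) : Continuous (synth a) := by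
  refine continuous_of_dominated (bound := fun ξ => ‖a ξ‖) (fun x => ?_) (fun x => ?_) ha.norm ?_
  · exact (integrable_expI_mul ha x).aestronglyMeasurable
  · exact Eventually.of_forall fun ξ => by simp
  · exact Eventually.of_forall fun ξ => by fun_prop

/-- `f` is the function `x ↦ ∫ e^{i⟨x,ξ⟩} a(ξ) dξ` for some `a` with `‖k a‖_{L²} ≤ M`. -/
def FourierRep (k : Sp n → ℝ) (f : Sp n → ℂ) (M : ℝ) : Prop :=
  0 ≤ M ∧ ∃ a : Sp n → ℂ, AEStronglyMeasurable a volume ∧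
    eLpNorm (fun ξ => (k ξ : ℂ) * a ξ) 2 volume ≤ ENNReal.ofReal M ∧ f = synth a

/-- The norm of `1 / k` in `L²`. -/
def invNorm (k : Sp n → ℝ) : ℝ := (eLpNorm (fun ξ => 1 / k ξ) 2 volume).toReal

theorem invNorm_nonneg (k : Sp n → ℝ) : 0 ≤ invNorm k := ENNReal.toReal_nonneg

namespace IsL2Weight

variable {k : Sp n → ℝ}

/-- Cauchy–Schwarz applied to a = (1/k) · (k a). -/
theorem eLpNorm_one_le (hk : IsL2Weight k) {a : Sp n → ℂ} (ha : AEStronglyMeasurable a volume) :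
    eLpNorm a 1 volume ≤ ENNReal.ofReal (invNorm k) *
      eLpNorm (fun ξ => (k ξ : ℂ) * a ξ) 2 volume := by
  have h1 : a = (fun ξ => 1 / k ξ) • (fun ξ => (k ξ : ℂ) * a ξ) := by
    funext ξ
    have : (k ξ : ℂ) ≠ 0 := by exact_mod_cast (hk.pos ξ).ne'
    simp [this]
  conv_lhs => rw [h1]
  rw [invNorm, ENNReal.ofReal_toReal hk.memLp.eLpNorm_ne_top]
  refine eLpNorm_smul_le_mul_eLpNorm (r := 1) ?_ hk.memLp.aestronglyMeasurable
  exact (Complex.measurable_ofReal.comp hk.measurable).aestronglyMeasurable.mul ha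

theorem integrable (hk : IsL2Weight k) {a : Sp n → ℂ} (ha : AEStronglyMeasurable a volume) {M : ℝ}
    (hM : eLpNorm (fun ξ => (k ξ : ℂ) * a ξ) 2 volume ≤ ENNReal.ofReal M) : Integrable a := by
  rw [← memLp_one_iff_integrable]
  refine ⟨ha, (hk.eLpNorm_one_le ha).trans_lt ?_⟩
  exact ENNReal.mul_lt_top ENNReal.ofReal_lt_top (hM.trans_lt ENNReal.ofReal_lt_top)

theorem integral_norm_le (hk : IsL2Weight k) {a : Sp n → ℂ}
    (ha : AEStronglyMeasurable a volume) {M : ℝ} (h0 : 0 ≤ M)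
    (hM : eLpNorm (fun ξ => (k ξ : ℂ) * a ξ) 2 volume ≤ ENNReal.ofReal M) :
    ∫ ξ, ‖a ξ‖ ≤ invNorm k * M := by
  have hi := hk.integrable ha hM
  rw [integral_norm_eq_lintegral_enorm ha, ← eLpNorm_one_eq_lintegral_enorm]
  refine ENNReal.toReal_le_of_le_ofReal (mul_nonneg (invNorm_nonneg k) h0) ?_
  rw [ENNReal.ofReal_mul (invNorm_nonneg k)]
  exact (hk.eLpNorm_one_le ha).trans (mul_le_mul_right hM _)

end IsL2Weight

namespace FourierRep

variable {k : Sp n → ℝ} {f g : Sp n → ℂ} {M N : ℝ}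

theorem nonneg (h : FourierRep k f M) : 0 ≤ M := h.1

theorem mono (h : FourierRep k f M) (hMN : M ≤ N) : FourierRep k f N := by
  obtain ⟨h0, a, ha, hM, hf⟩ := h
  exact ⟨h0.trans hMN, a, ha, hM.trans (ENNReal.ofReal_le_ofReal hMN), hf⟩

theorem norm_le (hk : IsL2Weight k) (h : FourierRep k f M) (x : Sp n) : ‖f x‖ ≤ invNorm k * M := by
  obtain ⟨h0, a, ha, hM, rfl⟩ := h
  exact (norm_synth_le a x).trans (hk.integral_norm_le ha h0 hM)

theorem continuous (hk : IsL2Weight k) (h : FourierRep k f M) : Continuous f := by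
  obtain ⟨h0, a, ha, hM, rfl⟩ := h
  exact continuous_synth (hk.integrable ha hM)

theorem zero (k : Sp n → ℝ) : FourierRep k (fun _ => 0) 0 := by
  refine ⟨le_rfl, fun _ => 0, aestronglyMeasurable_const, by simp, ?_⟩
  funext x
  simp [synth]

theorem const_mul (c : ℂ) (h : FourierRep k f M) : FourierRep k (fun x => c * f x) (‖c‖ * M) := by
  obtain ⟨h0, a, ha, hM, rfl⟩ := h
  refine ⟨by positivity, fun ξ => c * a ξ, ha.const_mul c, ?_, ?_⟩
  · have : (fun ξ => (k ξ : ℂ) * (c * a ξ)) = c • fun ξ => (k ξ : ℂ) * a ξ := by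
      funext ξ
      simp only [Pi.smul_apply, smul_eq_mul]
      ring
    rw [this, eLpNorm_const_smul, ENNReal.ofReal_mul (norm_nonneg c), ofReal_norm]
    exact mul_le_mul_right hM _
  · funext x
    rw [synth, synth, ← integral_const_mul]
    congr 1
    funext ξ
    ring

theorem add (hk : IsL2Weight k) (hf : FourierRep k f M) (hg : FourierRep k g N) :
    FourierRep k (fun x => f x + g x) (M + N) := by
  obtain ⟨h0, a, ha, hM, rfl⟩ := hf
  obtain ⟨h1, b, hb, hN, rfl⟩ := hg
  have hm : AEStronglyMeasurable (fun ξ => (k ξ : ℂ)) volume :=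
    (Complex.measurable_ofReal.comp hk.measurable).aestronglyMeasurable
  refine ⟨by positivity, fun ξ => a ξ + b ξ, ha.add hb, ?_, ?_⟩
  · simp only [mul_add]
    refine (eLpNorm_add_le (hm.mul ha) (hm.mul hb) one_le_two).trans ?_
    rw [ENNReal.ofReal_add h0 h1]
    exact add_le_add hM hN
  · funext x
    simp only [synth, mul_add]
    exact (integral_add (integrable_expI_mul (hk.integrable ha hM) x)
      (integrable_expI_mul (hk.integrable hb hN) x)).symm

theorem sum (hk : IsL2Weight k) {ι : Type*} (s : Finset ι) {f : ι → Sp n → ℂ} {M : ι → ℝ}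
    (h : ∀ i ∈ s, FourierRep k (f i) (M i)) :
    FourierRep k (fun x => ∑ i ∈ s, f i x) (∑ i ∈ s, M i) := by
  classical
  induction s using Finset.induction_on with
  | empty => simpa using FourierRep.zero k
  | insert i s hi ih =>
    simp only [Finset.sum_insert hi]
    exact (h i (Finset.mem_insert_self i s)).add hk
      (ih fun j hj => h j (Finset.mem_insert_of_mem hj))

end FourierRep

/-! ### Point evaluations, and stability under limits and averages -/

/-- The vectors in `L²` that represent point evaluations. -/
def evalVec {k : Sp n → ℝ} (hk : IsL2Weight k) (x : Sp n) : Lp ℂ 2 (volume : Measure (Sp n)) :=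
  MemLp.toLp (fun ξ => starRingEnd ℂ (expI x ξ) * ((1 / k ξ : ℝ) : ℂ)) <| by
    refine hk.memLp.ofReal (K := ℂ) |>.of_le_mul (c := 1) ?_ (Eventually.of_forall fun ξ => ?_)
    · refine AEStronglyMeasurable.mul (Continuous.aestronglyMeasurable ?_)
        hk.memLp.ofReal.aestronglyMeasurable
      exact Complex.continuous_conj.comp (continuous_expI_right x)
    · simp

/-- Putting β = k a turns the synthesis integral into an inner product with e^{-i⟨x,ξ⟩}/k(ξ), which
is square integrable. So `FourierRep k · M` is a ball in a reproducing kernel Hilbert space. -/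
theorem rep_iff_exists_inner {k : Sp n → ℝ} (hk : IsL2Weight k) {f : Sp n → ℂ} {M : ℝ}
    (hM : 0 ≤ M) :
    FourierRep k f M ↔ ∃ β : Lp ℂ 2 (volume : Measure (Sp n)), ‖β‖ ≤ M ∧
      ∀ x, f x = inner ℂ (evalVec hk x) β := by
  have hm : AEStronglyMeasurable (fun ξ => (k ξ : ℂ)) volume :=
    (Complex.measurable_ofReal.comp hk.measurable).aestronglyMeasurable
  constructor
  · rintro ⟨-, a, ha, haM, rfl⟩
    have hmem : MemLp (fun ξ => (k ξ : ℂ) * a ξ) 2 volume :=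
      ⟨hm.mul ha, haM.trans_lt ENNReal.ofReal_lt_top⟩
    refine ⟨hmem.toLp _, ?_, fun x => ?_⟩
    · rw [Lp.norm_toLp]
      exact ENNReal.toReal_le_of_le_ofReal hM haM
    · rw [L2.inner_def]
      refine integral_congr_ae ?_
      filter_upwards [hmem.coeFn_toLp, MemLp.coeFn_toLp (μ := volume) (p := 2)
        (f := fun ξ => starRingEnd ℂ (expI x ξ) * ((1 / k ξ : ℝ) : ℂ)) _] with ξ h1 h2
      have : (k ξ : ℂ) ≠ 0 := by exact_mod_cast (hk.pos ξ).ne'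
      rw [h1, evalVec, h2]
      simp only [RCLike.inner_apply, map_mul, Complex.conj_conj, Complex.conj_ofReal]
      push_cast
      field_simp
  · rintro ⟨β, hβ, hf⟩
    refine ⟨hM, fun ξ => ((1 / k ξ : ℝ) : ℂ) * β ξ, ?_, ?_, ?_⟩
    · exact hk.memLp.ofReal.aestronglyMeasurable.mul (Lp.aestronglyMeasurable β)
    · have : (fun ξ => (k ξ : ℂ) * (((1 / k ξ : ℝ) : ℂ) * β ξ)) = β := by
        funext ξ
        have : (k ξ : ℂ) ≠ 0 := by exact_mod_cast (hk.pos ξ).ne'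
        push_cast
        field_simp
      rw [this, ← Lp.enorm_def, ← ofReal_norm]
      exact ENNReal.ofReal_le_ofReal hβ
    · funext x
      rw [hf, L2.inner_def]
      refine integral_congr_ae ?_
      filter_upwards [MemLp.coeFn_toLp (μ := volume) (p := 2)
        (f := fun ξ => starRingEnd ℂ (expI x ξ) * ((1 / k ξ : ℝ) : ℂ)) _] with ξ h2
      rw [evalVec, h2]
      simp only [RCLike.inner_apply, map_mul, Complex.conj_conj, Complex.conj_ofReal]
      ring

namespace FourierRep

variable {k : Sp n → ℝ}

theorem norm_linearCombination_le (hk : IsL2Weight k) {f : Sp n → ℂ} {M : ℝ} (h : FourierRep k f M)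
    (c : Sp n →₀ ℂ) :
    ‖Finsupp.linearCombination ℂ (fun x => starRingEnd ℂ (f x)) c‖ ≤
      M * ‖Finsupp.linearCombination ℂ (evalVec hk) c‖ := by
  obtain ⟨β, hβ, hf⟩ := (rep_iff_exists_inner hk h.nonneg).1 h
  exact (norm_linearCombination_le_of_inner_eq hf c).trans
    (mul_le_mul_of_nonneg_right hβ (norm_nonneg _))

/-- Each inequality involves finitely many values of f, so the criterion survives pointwise limits
and integration over a parameter, without a measurable choice of the coefficient functions. -/
theorem of_forall_norm_le (hk : IsL2Weight k) {f : Sp n → ℂ} {M : ℝ} (hM : 0 ≤ M)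
    (h : ∀ c : Sp n →₀ ℂ, ‖Finsupp.linearCombination ℂ (fun x => starRingEnd ℂ (f x)) c‖ ≤
      M * ‖Finsupp.linearCombination ℂ (evalVec hk) c‖) : FourierRep k f M :=
  (rep_iff_exists_inner hk hM).2 (exists_inner_eq_of_forall_norm_le _ f hM h)

/-- Pointwise limits of bounded families. -/
theorem of_tendsto (hk : IsL2Weight k) {ι : Type*} {l : Filter ι} [l.NeBot] {F : ι → Sp n → ℂ}
    {f : Sp n → ℂ} {M : ℝ} (hF : ∀ i, FourierRep k (F i) M)
    (hlim : ∀ x, Tendsto (fun i => F i x) l (𝓝 (f x))) : FourierRep k f M := by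
  obtain ⟨i₀⟩ : Nonempty ι := l.nonempty_of_neBot
  refine of_forall_norm_le hk (hF i₀).nonneg fun c => ?_
  refine le_of_tendsto (x := l) (f := fun i =>
    ‖Finsupp.linearCombination ℂ (fun x => starRingEnd ℂ (F i x)) c‖) ?_
    (Eventually.of_forall fun i => (hF i).norm_linearCombination_le hk c)
  refine Tendsto.norm ?_
  simp only [Finsupp.linearCombination_apply, Finsupp.sum]
  refine tendsto_finsetSum _ fun x _ => ?_
  exact ((Complex.continuous_conj.tendsto _).comp (hlim x)).const_smul _

/-- Averages of families. -/
theorem integral (hk : IsL2Weight k) {Θ : Type*} [MeasurableSpace Θ] {μ : Measure Θ}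
    {F : Θ → Sp n → ℂ} {M : Θ → ℝ} (hF : ∀ θ, FourierRep k (F θ) (M θ)) (hM : Integrable M μ)
    (hint : ∀ x, Integrable (fun θ => F θ x) μ) :
    FourierRep k (fun x => ∫ θ, F θ x ∂μ) (∫ θ, M θ ∂μ) := by
  refine of_forall_norm_le hk (integral_nonneg fun θ => (hF θ).nonneg) fun c => ?_
  have : Finsupp.linearCombination ℂ (fun x => starRingEnd ℂ (∫ θ, F θ x ∂μ)) c =
      ∫ θ, Finsupp.linearCombination ℂ (fun x => starRingEnd ℂ (F θ x)) c ∂μ := by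
    simp only [Finsupp.linearCombination_apply, Finsupp.sum]
    rw [integral_finsetSum _ fun x _ => ?_]
    · refine Finset.sum_congr rfl fun x _ => ?_
      rw [integral_smul, integral_conj]
    · exact Integrable.smul (c x) ((Complex.conjCLE : ℂ →L[ℝ] ℂ).integrable_comp (hint x))
  rw [this, ← integral_mul_const]
  exact norm_integral_le_of_norm_le (hM.mul_const _)
    (Eventually.of_forall fun θ => (hF θ).norm_linearCombination_le hk c)

end FourierRep

/-! ### The algebra property -/

theorem sq_lintegral_mul_le {α : Type*} [MeasurableSpace α] (μ : Measure α) {f g : α → ℝ≥0∞}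
    (hf : AEMeasurable f μ) (hg : AEMeasurable g μ) :
    (∫⁻ x, f x * g x ∂μ) ^ 2 ≤ (∫⁻ x, f x ^ 2 ∂μ) * ∫⁻ x, g x ^ 2 ∂μ := by
  have h := ENNReal.lintegral_mul_le_Lp_mul_Lq μ Real.HolderConjugate.two_two hf hg
  have h2 : ∀ y : ℝ≥0∞, (y ^ (1 / 2 : ℝ)) ^ 2 = y := fun y => by
    rw [← ENNReal.rpow_natCast, ← ENNReal.rpow_mul]; simp
  calc (∫⁻ x, f x * g x ∂μ) ^ 2 ≤ _ := pow_le_pow_left' h 2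
    _ = _ := by simp only [mul_pow, h2, ENNReal.rpow_two]

theorem sq_eLpNorm_two {α : Type*} [MeasurableSpace α] (μ : Measure α) (f : α → ℂ) :
    eLpNorm f 2 μ ^ 2 = ∫⁻ x, ‖f x‖ₑ ^ 2 ∂μ := by
  have := eLpNorm_nnreal_pow_eq_lintegral (μ := μ) (f := f) (p := 2) two_ne_zero
  simpa using this

/-- The coefficient function of a product. -/
theorem synth_mul_synth {a b : Sp n → ℂ} (ha : Integrable a) (hb : Integrable b) (x : Sp n) :
    synth a x * synth b x = synth (fun ξ => ∫ η, a η * b (ξ - η)) x := by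
  have h := integral_convolution (ContinuousLinearMap.mul ℂ ℂ) (integrable_expI_mul ha x)
    (integrable_expI_mul hb x)
  simp only [ContinuousLinearMap.mul_apply'] at h
  rw [synth, synth, ← h, synth]
  refine integral_congr_ae (Eventually.of_forall fun ξ => ?_)
  simp only [convolution_def, ContinuousLinearMap.mul_apply']
  rw [← integral_const_mul]
  congr 1
  funext η
  have : expI x ξ = expI x η * expI x (ξ - η) := by rw [← expI_add_right]; congr 1; abel
  rw [this]
  ring

theorem FourierRep.exists_measurable {k : Sp n → ℝ} {f : Sp n → ℂ} {M : ℝ} (h : FourierRep k f M) :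
    ∃ a : Sp n → ℂ, Measurable a ∧
      eLpNorm (fun ξ => (k ξ : ℂ) * a ξ) 2 volume ≤ ENNReal.ofReal M ∧ f = synth a := by
  obtain ⟨h0, a, ha, hM, rfl⟩ := h
  refine ⟨ha.mk a, ha.stronglyMeasurable_mk.measurable, (le_of_eq ?_).trans hM, ?_⟩
  · refine eLpNorm_congr_ae ?_
    filter_upwards [ha.ae_eq_mk] with ξ h
    rw [h]
  · funext x
    refine integral_congr_ae ?_
    filter_upwards [ha.ae_eq_mk] with ξ h
    rw [h]

/-- If `(1/k²) * (1/k²) ≤ C²/k²`, then the functions with coefficients in `L²(k² dξ)` form an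
algebra. -/
theorem FourierRep.mul {k : Sp n → ℝ} (hk : IsL2Weight k) {C : ℝ} (hC : 0 < C)
    (hconv : ∀ ξ, ∫⁻ η, ENNReal.ofReal (1 / k η ^ 2) * ENNReal.ofReal (1 / k (ξ - η) ^ 2) ≤
      ENNReal.ofReal (C ^ 2 / k ξ ^ 2))
    {f g : Sp n → ℂ} {M N : ℝ} (hf : FourierRep k f M) (hg : FourierRep k g N) :
    FourierRep k (fun x => f x * g x) (C * M * N) := by
  have hM0 := hf.nonneg
  have hN0 := hg.nonneg
  obtain ⟨a, ha, hM, rfl⟩ := hf.exists_measurable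
  obtain ⟨b, hb, hN, rfl⟩ := hg.exists_measurable
  have hai := hk.integrable ha.aestronglyMeasurable hM
  have hbi := hk.integrable hb.aestronglyMeasurable hN
  have hkm := hk.measurable
  refine ⟨by positivity, fun ξ => ∫ η, a η * b (ξ - η), ?_, ?_, funext (synth_mul_synth hai hbi)⟩
  · exact (Integrable.integrable_convolution (ContinuousLinearMap.mul ℂ ℂ) hai
      hbi).aestronglyMeasurable
  let A : Sp n → ℝ≥0∞ := fun ξ => ‖(k ξ : ℂ) * a ξ‖ₑ
  let B : Sp n → ℝ≥0∞ := fun ξ => ‖(k ξ : ℂ) * b ξ‖ₑ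
  let W : Sp n → ℝ≥0∞ := fun ξ => ENNReal.ofReal (1 / k ξ)
  have hA : Measurable A := by fun_prop
  have hB : Measurable B := by fun_prop
  have hW : Measurable W := by fun_prop
  have hWA : ∀ (c : Sp n → ℂ) ξ, ‖c ξ‖ₑ = W ξ * ‖(k ξ : ℂ) * c ξ‖ₑ := by
    intro c ξ
    have h1 : W ξ = ‖((1 / k ξ : ℝ) : ℂ)‖ₑ := by
      rw [← ofReal_norm, Complex.norm_real, Real.norm_of_nonneg (by have := hk.pos ξ; positivity)]
    have : (k ξ : ℂ) ≠ 0 := by exact_mod_cast (hk.pos ξ).ne'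
    rw [h1, ← enorm_mul]
    congr 1
    push_cast
    field_simp
  have hW2 : ∀ ξ, W ξ ^ 2 = ENNReal.ofReal (1 / k ξ ^ 2) := by
    intro ξ
    rw [← ENNReal.ofReal_pow (by have := hk.pos ξ; positivity)]
    congr 1
    ring
  -- Write |a(η) b(ξ-η)| as W(η)W(ξ-η) times A(η)B(ξ-η), where W = 1/k. After Cauchy–Schwarz the
  -- first integral is at most C²/k(ξ)², which the factor k(ξ)² cancels. Tonelli then finishes the
  -- estimate.
  have hpt : ∀ ξ, ‖(k ξ : ℂ) * ∫ η, a η * b (ξ - η)‖ₑ ^ 2 ≤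
      ENNReal.ofReal (C ^ 2) * ∫⁻ η, A η ^ 2 * B (ξ - η) ^ 2 := by
    intro ξ
    have h1 : ‖∫ η, a η * b (ξ - η)‖ₑ ≤ ∫⁻ η, (W η * W (ξ - η)) * (A η * B (ξ - η)) := by
      refine (enorm_integral_le_lintegral_enorm _).trans (le_of_eq ?_)
      refine lintegral_congr fun η => ?_
      rw [enorm_mul, hWA a η, hWA b (ξ - η)]
      ring
    have h2 : ‖∫ η, a η * b (ξ - η)‖ₑ ^ 2 ≤
        ENNReal.ofReal (C ^ 2 / k ξ ^ 2) * ∫⁻ η, A η ^ 2 * B (ξ - η) ^ 2 := by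
      refine (pow_le_pow_left' h1 2).trans ((sq_lintegral_mul_le _ (by fun_prop)
        (by fun_prop)).trans ?_)
      simp only [mul_pow, hW2]
      exact mul_le_mul_left (hconv ξ) _
    rw [enorm_mul, mul_pow]
    refine (mul_le_mul_right h2 _).trans (le_of_eq ?_)
    rw [← mul_assoc]
    congr 1
    have : ‖(k ξ : ℂ)‖ₑ = ENNReal.ofReal (k ξ) := by
      rw [← ofReal_norm, Complex.norm_real, Real.norm_of_nonneg (hk.pos ξ).le]
    rw [this, ← ENNReal.ofReal_pow (hk.pos ξ).le, ← ENNReal.ofReal_mul (by positivity)]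
    congr 1
    have := (hk.pos ξ).ne'
    field_simp
  have hsq : eLpNorm (fun ξ => (k ξ : ℂ) * ∫ η, a η * b (ξ - η)) 2 volume ^ 2 ≤
      ENNReal.ofReal (C * M * N) ^ 2 := by
    rw [sq_eLpNorm_two]
    calc _ ≤ ∫⁻ ξ, ENNReal.ofReal (C ^ 2) * ∫⁻ η, A η ^ 2 * B (ξ - η) ^ 2 := lintegral_mono hpt
      _ = ENNReal.ofReal (C ^ 2) * ∫⁻ η, ∫⁻ ξ, A η ^ 2 * B (ξ - η) ^ 2 := by
        rw [lintegral_const_mul' _ _ ENNReal.ofReal_ne_top, lintegral_lintegral_swap]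
        exact (by fun_prop : Measurable (fun p : Sp n × Sp n =>
          A p.2 ^ 2 * B (p.1 - p.2) ^ 2)).aemeasurable
      _ = ENNReal.ofReal (C ^ 2) * ((∫⁻ η, A η ^ 2) * ∫⁻ ξ, B ξ ^ 2) := by
        congr 1
        rw [← lintegral_mul_const _ (by fun_prop)]
        refine lintegral_congr fun η => ?_
        rw [lintegral_const_mul _ (by fun_prop), lintegral_sub_right_eq_self (fun ξ => B ξ ^ 2) η]
      _ ≤ ENNReal.ofReal (C ^ 2) * (ENNReal.ofReal M ^ 2 * ENNReal.ofReal N ^ 2) := by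
        simp only [A, B]
        rw [← sq_eLpNorm_two, ← sq_eLpNorm_two]
        gcongr
      _ = ENNReal.ofReal (C * M * N) ^ 2 := by
        rw [ENNReal.ofReal_mul (by positivity), ENNReal.ofReal_mul hC.le,
          ENNReal.ofReal_pow hC.le]
        ring
  rw [← ENNReal.rpow_two, ← ENNReal.rpow_two] at hsq
  exact (ENNReal.rpow_le_rpow_iff two_pos).1 hsq

/-! ### Modulations and multiplication by smooth functions -/

theorem one_le_bracket (ξ : Sp n) : 1 ≤ bracket ξ := by
  rw [bracket]; exact Real.one_le_sqrt.2 (by nlinarith [sq_nonneg ‖ξ‖])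

theorem bracket_le (ξ : Sp n) : bracket ξ ≤ 1 + ‖ξ‖ := by
  rw [bracket]
  exact Real.sqrt_le_iff.2 ⟨by positivity, by nlinarith [norm_nonneg ξ]⟩

theorem continuous_bracket : Continuous (bracket : Sp n → ℝ) := by
  unfold bracket; fun_prop

/-- A character shifts the coefficients by η, and the weight changes under this shift by at most the
factor D. -/
theorem FourierRep.modulate {k : Sp n → ℝ} (hk : IsL2Weight k) {D : ℝ} (hD : 0 ≤ D) {η : Sp n}
    (hle : ∀ ξ, k (η + ξ) ≤ D * k ξ) {f : Sp n → ℂ} {M : ℝ} (hf : FourierRep k f M) :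
    FourierRep k (fun x => expI x η * f x) (D * M) := by
  obtain ⟨h0, a, ha, hM, rfl⟩ := hf
  have hm : AEStronglyMeasurable (fun ξ => (k ξ : ℂ)) volume :=
    (Complex.measurable_ofReal.comp hk.measurable).aestronglyMeasurable
  have hmp : MeasurePreserving (fun ξ : Sp n => ξ - η) volume volume :=
    measurePreserving_sub_right volume η
  have ha' : AEStronglyMeasurable (fun ξ => a (ξ - η)) volume := ha.comp_measurePreserving hmp
  refine ⟨by positivity, fun ξ => a (ξ - η), ha', ?_, ?_⟩
  · rw [ENNReal.ofReal_mul hD]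
    refine le_trans ?_ (mul_le_mul_right hM _)
    have h1 := eLpNorm_comp_measurePreserving (p := 2) (hm.mul ha) hmp
    change _ = eLpNorm (fun ξ => (k ξ : ℂ) * a ξ) 2 volume at h1
    rw [← h1]
    refine eLpNorm_le_mul_eLpNorm_of_ae_le_mul (Eventually.of_forall fun ξ => ?_) 2
    simp only [Function.comp_apply, Pi.mul_apply, norm_mul, Complex.norm_real,
      Real.norm_of_nonneg (hk.pos _).le, ← mul_assoc]
    refine mul_le_mul_of_nonneg_right ?_ (norm_nonneg _)
    simpa using hle (ξ - η)
  · funext x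
    rw [synth, synth, ← integral_const_mul,
      ← integral_sub_right_eq_self (fun ξ => expI x η * (expI x ξ * a ξ)) η]
    congr 1
    funext ξ
    have : expI x ξ = expI x η * expI x (ξ - η) := by rw [← expI_add_right]; congr 1; abel
    rw [this]
    ring

/-- Multiplication by translates of a function whose coefficients have finite moments. -/
theorem FourierRep.synth_mul {k : Sp n → ℝ} (hk : IsL2Weight k) {C N : ℝ} (hC : 0 < C)
    (hle : ∀ ξ η, k (ξ + η) ≤ C * bracket ξ ^ N * k η) {b : Sp n → ℂ} (hb : Integrable b)
    (hbN : Integrable fun ξ => bracket ξ ^ N * ‖b ξ‖) {f : Sp n → ℂ} {M : ℝ} (hf : FourierRep k f M)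
    (y : Sp n) :
    FourierRep k (fun x => synth b (x - y) * f x) (C * (∫ ξ, bracket ξ ^ N * ‖b ξ‖) * M) := by
  have hbr : ∀ η : Sp n, 0 ≤ C * bracket η ^ N := fun η =>
    mul_nonneg hC.le (Real.rpow_nonneg (zero_le_one.trans (one_le_bracket η)) _)
  -- The product is a superposition of modulations of f. Translating by y only multiplies b(η) by
  -- the phase e^{-i⟨y,η⟩}, so the bound does not depend on y.
  have h1 : ∀ η, FourierRep k (fun x => (expI (-y) η * b η) * (expI x η * f x))
      (‖expI (-y) η * b η‖ * (C * bracket η ^ N * M)) := fun η =>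
    (hf.modulate hk (hbr η) (hle η)).const_mul _
  have h2 := FourierRep.integral hk (μ := volume) h1 ?_ ?_
  · convert h2 using 1
    · funext x
      rw [synth, ← integral_mul_const]
      congr 1
      funext η
      rw [sub_eq_add_neg, expI_add_left]
      ring
    · rw [← integral_const_mul, ← integral_mul_const]
      congr 1
      funext η
      simp only [norm_mul, norm_expI]
      ring
  · refine (hbN.const_mul (C * M)).congr (Eventually.of_forall fun η => ?_)
    simp only [norm_mul, norm_expI]
    ring
  · intro x
    have := ((integrable_expI_mul hb (x - y)).mul_const (f x))
    refine this.congr (Eventually.of_forall fun η => ?_)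
    simp only
    rw [sub_eq_add_neg, expI_add_left]
    ring

/-! ### Fourier inversion -/

/-- Fourier inversion for the exponential `e^{i⟨x,ξ⟩}`. -/
theorem eq_synth_fourier {h : Sp n → ℂ} (hc : Continuous h) (hi : Integrable h)
    (hF : Integrable (𝓕 h)) :
    h = synth (fun ξ => ((2 * Real.pi : ℝ) ^ n : ℂ)⁻¹ * 𝓕 h ((2 * Real.pi)⁻¹ • ξ)) := by
  funext x
  rw [← congrFun (hc.fourierInv_fourier_eq hi hF) x, Real.fourierInv_eq', synth]
  have := Measure.integral_comp_inv_smul_of_nonneg (volume : Measure (Sp n))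
    (fun η => expI x ((2 * Real.pi) • η) * (((2 * Real.pi : ℝ) ^ n : ℂ)⁻¹ * 𝓕 h η))
    (R := 2 * Real.pi) (by positivity)
  have h2 : ∀ ξ : Sp n, (2 * Real.pi) • (2 * Real.pi)⁻¹ • ξ = ξ := fun ξ =>
    smul_inv_smul₀ (by positivity) ξ
  simp only [h2] at this
  rw [this, finrank_euclideanSpace_fin, ← integral_smul]
  congr 1
  funext η
  have h3 : ((2 * Real.pi : ℝ) ^ n : ℂ) ≠ 0 := by
    apply pow_ne_zero; simp [Real.pi_ne_zero]
  have h4 : expI x ((2 * Real.pi) • η) =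
      Complex.exp (((2 * Real.pi * inner ℝ η x : ℝ) : ℂ) * Complex.I) := by
    rw [expI, inner_smul_right, real_inner_comm, mul_comm]
  rw [h4, Complex.real_smul, smul_eq_mul]
  push_cast at h3 ⊢
  field_simp

theorem fourierS_apply_eq (φ : 𝓢(Sp n, ℂ)) (ξ : Sp n) :
    fourierS φ ξ = 𝓕 (φ : Sp n → ℂ) ((2 * Real.pi)⁻¹ • ξ) := by
  change (𝓕 φ : 𝓢(Sp n, ℂ)) (((2 * Real.pi)⁻¹ : ℝ) • ξ) = _
  rw [SchwartzMap.fourier_coe]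

theorem schwartz_eq_synth (φ : 𝓢(Sp n, ℂ)) :
    (φ : Sp n → ℂ) = synth (((2 * Real.pi : ℝ) ^ n : ℂ)⁻¹ • fourierS φ) := by
  have h := eq_synth_fourier φ.continuous φ.integrable (by
    rw [← SchwartzMap.fourier_coe]; exact (𝓕 φ : 𝓢(Sp n, ℂ)).integrable)
  refine h.trans (congrArg synth (funext fun ξ => ?_))
  simp [fourierS_apply_eq]

theorem integrable_bracket_rpow_mul (φ : 𝓢(Sp n, ℂ)) (N : ℝ) :
    Integrable fun ξ => bracket ξ ^ N * ‖φ ξ‖ := by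
  obtain ⟨m, hm⟩ := exists_nat_ge N
  have h1 := ((φ.integrable_pow_mul volume m).add φ.integrable.norm).const_mul (2 ^ m)
  refine h1.mono' ?_ (Eventually.of_forall fun ξ => ?_)
  · refine Continuous.aestronglyMeasurable ?_
    refine Continuous.mul (continuous_bracket.rpow_const fun ξ => Or.inl ?_) φ.continuous.norm
    exact (zero_lt_one.trans_le (one_le_bracket ξ)).ne'
  · have hb : bracket ξ ^ N ≤ 2 ^ m * (‖ξ‖ ^ m + 1) := by
      calc bracket ξ ^ N ≤ bracket ξ ^ (m : ℝ) :=
            Real.rpow_le_rpow_of_exponent_le (one_le_bracket ξ) hm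
        _ = bracket ξ ^ m := Real.rpow_natCast _ _
        _ ≤ (1 + ‖ξ‖) ^ m :=
            pow_le_pow_left₀ (zero_le_one.trans (one_le_bracket ξ)) (bracket_le ξ) m
        _ ≤ 2 ^ (m - 1) * (1 ^ m + ‖ξ‖ ^ m) := add_pow_le zero_le_one (norm_nonneg _) m
        _ ≤ 2 ^ m * (‖ξ‖ ^ m + 1) := by
          rw [one_pow, add_comm]
          gcongr
          · norm_num
          · omega
    rw [Real.norm_of_nonneg (mul_nonneg (Real.rpow_nonneg (zero_le_one.trans (one_le_bracket ξ)) _)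
      (norm_nonneg _))]
    calc _ ≤ 2 ^ m * (‖ξ‖ ^ m + 1) * ‖φ ξ‖ := mul_le_mul_of_nonneg_right hb (norm_nonneg _)
      _ = _ := by simp only [Pi.add_apply]; ring

/-- Multiplication by translates of a Schwartz function is bounded, uniformly in the
translation. -/
theorem exists_rep_schwartz_mul {k : Sp n → ℝ} (hk : IsL2Weight k) (hpol : IsKpol k)
    (φ : 𝓢(Sp n, ℂ)) : ∃ C : ℝ, 0 ≤ C ∧ ∀ (f : Sp n → ℂ) (M : ℝ), FourierRep k f M → ∀ y,
      FourierRep k (fun x => φ (x - y) * f x) (C * M) := by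
  obtain ⟨-, -, C, N, hC, -, hle⟩ := hpol
  let b : 𝓢(Sp n, ℂ) := ((2 * Real.pi : ℝ) ^ n : ℂ)⁻¹ • fourierS φ
  refine ⟨C * ∫ ξ, bracket ξ ^ N * ‖b ξ‖, ?_, fun f M hf y => ?_⟩
  · refine mul_nonneg hC.le (integral_nonneg fun ξ => mul_nonneg (Real.rpow_nonneg ?_ _)
      (norm_nonneg _))
    exact zero_le_one.trans (one_le_bracket ξ)
  · have := hf.synth_mul hk hC hle b.integrable (integrable_bracket_rpow_mul b N) y
    rwa [show synth (b : Sp n → ℂ) = φ from (schwartz_eq_synth φ).symm] at this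

/-! ### Smooth functions with compact support -/

/-- Integration by parts trades m derivatives for the decay (1 + |w|)^{-m}. Only L¹ norms of the
derivatives enter, hence only the volume of the ball and not its centre. -/
theorem pow_one_add_norm_mul_norm_fourier_le (ρ : ℝ) (m : ℕ) :
    ∃ C : ℝ, 0 ≤ C ∧ ∀ (y : Sp n) (h : Sp n → ℂ) (B : ℝ), ContDiff ℝ m h →
      (∀ x ∉ Metric.closedBall y ρ, h x = 0) → (∀ i ≤ m, ∀ x, ‖iteratedFDeriv ℝ i h x‖ ≤ B) →
      ∀ w, (1 + ‖w‖) ^ m * ‖𝓕 h w‖ ≤ C * B := by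
  let V : ℝ := (volume (Metric.closedBall (0 : Sp n) ρ)).toReal
  refine ⟨2 ^ m * (V + 2 ^ m * ((m + 1) * V)), by positivity, fun y h B hh hsupp hB w => ?_⟩
  have hts : tsupport h ⊆ Metric.closedBall y ρ := by
    refine closure_minimal (fun x hx => ?_) Metric.isClosed_closedBall
    by_contra hx'
    exact hx (hsupp x hx')
  have hcs : HasCompactSupport h :=
    HasCompactSupport.of_support_subset_isCompact (isCompact_closedBall y ρ)
      (subset_closure.trans hts)
  have hint : ∀ i ≤ m, Integrable (fun v => ‖iteratedFDeriv ℝ i h v‖) := by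
    intro i hi
    have hci : Continuous (iteratedFDeriv ℝ i h) :=
      hh.continuous_iteratedFDeriv (by exact_mod_cast hi)
    refine hci.norm.integrable_of_hasCompactSupport ?_
    exact (hcs.iteratedFDeriv i).norm
  have hVy : (volume.real (Metric.closedBall y ρ)) = V := by
    simp only [V, Measure.real]
    rw [Measure.addHaar_closedBall_center]
  have hintle : ∀ i ≤ m, ∫ v, ‖iteratedFDeriv ℝ i h v‖ ≤ V * B := by
    intro i hi
    have h1 : ∫ v, ‖iteratedFDeriv ℝ i h v‖ =
        ∫ v in Metric.closedBall y ρ, ‖iteratedFDeriv ℝ i h v‖ := by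
      rw [setIntegral_eq_integral_of_forall_compl_eq_zero]
      intro x hx
      rw [norm_eq_zero]
      by_contra hne
      exact hx (hts (support_iteratedFDeriv_subset i hne))
    rw [h1]
    have h2 := norm_setIntegral_le_of_norm_le_const (μ := volume) (s := Metric.closedBall y ρ)
      (f := fun v => ‖iteratedFDeriv ℝ i h v‖) (C := B) measure_closedBall_lt_top
      (fun x _ => by simpa using hB i hi x)
    rw [hVy, mul_comm] at h2
    exact (le_abs_self _).trans h2
  have hpow : ∀ j ≤ m, ‖w‖ ^ j * ‖𝓕 h w‖ ≤ 2 ^ j * ((j + 1) * (V * B)) := by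
    intro j hj
    -- No derivative of the transform is taken (order 0), so no moments of h appear.
    have h1 := Real.pow_mul_norm_iteratedFDeriv_fourier_le (K := 0) (N := (m : ℕ∞)) (f := h)
      (by exact_mod_cast hh) (fun k i hk hi => by
        have : k = 0 := by exact_mod_cast (nonpos_iff_eq_zero.1 hk)
        subst this
        simpa using hint i (by exact_mod_cast hi)) (k := 0) (n := j) le_rfl (by exact_mod_cast hj) w
    rw [norm_iteratedFDeriv_zero] at h1
    refine h1.trans ?_
    simp only [pow_zero, Nat.cast_zero, mul_zero, zero_add, one_mul]
    refine mul_le_mul_of_nonneg_left ?_ (by positivity)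
    refine (Finset.sum_le_card_nsmul _ _ (V * B) fun p hp => ?_).trans (le_of_eq ?_)
    · simp only [Finset.mem_product, Finset.mem_range] at hp
      have : p.1 = 0 := by omega
      simpa [this] using hintle p.2 (by omega)
    · simp
  have hV0 : 0 ≤ V := ENNReal.toReal_nonneg
  calc (1 + ‖w‖) ^ m * ‖𝓕 h w‖ ≤ (2 ^ m * (1 + ‖w‖ ^ m)) * ‖𝓕 h w‖ := by
        refine mul_le_mul_of_nonneg_right ?_ (norm_nonneg _)
        refine (add_pow_le zero_le_one (norm_nonneg w) m).trans ?_
        rw [one_pow]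
        gcongr
        · norm_num
        · omega
    _ = 2 ^ m * (‖w‖ ^ 0 * ‖𝓕 h w‖ + ‖w‖ ^ m * ‖𝓕 h w‖) := by ring
    _ ≤ 2 ^ m * (2 ^ 0 * (((0 : ℕ) + 1) * (V * B)) + 2 ^ m * ((m + 1) * (V * B))) := by
        exact mul_le_mul_of_nonneg_left
          (add_le_add (hpow 0 (Nat.zero_le m)) (hpow m le_rfl)) (by positivity)
    _ = _ := by push_cast; ring

theorem memLp_one_add_norm (n : ℕ) :
    MemLp (fun ξ : Sp n => (1 + ‖ξ‖) ^ (-((n : ℝ) + 1))) 2 volume := by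
  have hc : Continuous (fun ξ : Sp n => (1 + ‖ξ‖) ^ (-((n : ℝ) + 1))) :=
    Continuous.rpow_const (by fun_prop) fun ξ => Or.inl (by positivity)
  refine (memLp_two_iff_integrable_sq hc.aestronglyMeasurable).2 ?_
  have := integrable_one_add_norm (E := Sp n) (μ := volume) (r := 2 * ((n : ℝ) + 1))
    (by rw [finrank_euclideanSpace_fin]; linarith [(Nat.cast_nonneg n : (0 : ℝ) ≤ n)])
  refine this.congr (Eventually.of_forall fun ξ => ?_)
  simp only
  rw [← Real.rpow_natCast, ← Real.rpow_mul (by positivity)]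
  congr 1
  push_cast
  ring

/-- Smooth functions supported in a ball have coefficients in every weighted space, with a bound
that does not depend on the centre of the ball. -/
theorem exists_rep_of_contDiff {k : Sp n → ℝ} (hpol : IsKpol k) (ρ : ℝ) :
    ∃ (m : ℕ) (C : ℝ), 0 ≤ C ∧ ∀ (y : Sp n) (h : Sp n → ℂ) (B : ℝ), ContDiff ℝ m h →
      (∀ x ∉ Metric.closedBall y ρ, h x = 0) → (∀ i ≤ m, ∀ x, ‖iteratedFDeriv ℝ i h x‖ ≤ B) →
      FourierRep k h (C * B) := by
  obtain ⟨hkm, hkpos, C₀, N, hC₀, hN, hle⟩ := hpol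
  -- N powers of decay compensate the growth of k, and n + 1 more leave a square integrable
  -- function.
  obtain ⟨m, hm⟩ := exists_nat_ge (N + ((n : ℝ) + 1))
  obtain ⟨C₁, hC₁, hF⟩ := pow_one_add_norm_mul_norm_fourier_le (n := n) ρ m
  let L : ℝ := (eLpNorm (fun ξ : Sp n => (1 + ‖ξ‖) ^ (-((n : ℝ) + 1))) 2 volume).toReal
  let c : ℝ := ((2 * Real.pi) ^ n)⁻¹
  have hc0 : 0 ≤ c := by positivity
  -- C₀ k(0) comes from k(ξ) ≤ C₀⟨ξ⟩^N k(0), c from Fourier inversion, and (2π)^m from undoing the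
  -- dilation: 1 + |ξ| ≤ 2π (1 + |ξ/2π|).
  let D : ℝ := C₀ * k 0 * (c * ((2 * Real.pi) ^ m * C₁))
  have hD : 0 ≤ D := by
    have := (hkpos 0).le
    positivity
  have hdecay : ∀ (y : Sp n) (h : Sp n → ℂ) (B : ℝ), ContDiff ℝ m h →
      (∀ x ∉ Metric.closedBall y ρ, h x = 0) → (∀ i ≤ m, ∀ x, ‖iteratedFDeriv ℝ i h x‖ ≤ B) →
      ∀ w, ‖𝓕 h w‖ ≤ C₁ * B * (1 + ‖w‖) ^ (-(m : ℝ)) := by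
    intro y h B hh hs hB w
    rw [Real.rpow_neg (by positivity), Real.rpow_natCast, ← div_eq_mul_inv,
      le_div_iff₀ (by positivity), mul_comm]
    exact hF y h B hh hs hB w
  refine ⟨m, D * L, mul_nonneg hD ENNReal.toReal_nonneg, fun y h B hh hs hB => ?_⟩
  have hB0 : 0 ≤ B := (norm_nonneg _).trans (hB 0 (Nat.zero_le _) 0)
  have hcs : HasCompactSupport h := by
    refine HasCompactSupport.of_support_subset_isCompact (isCompact_closedBall y ρ) fun x hx => ?_
    by_contra hx'
    exact hx (hs x hx')
  have hi : Integrable h := hh.continuous.integrable_of_hasCompactSupport hcs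
  have hFc : Continuous (𝓕 h) :=
    VectorFourier.fourierIntegral_continuous Real.continuous_fourierChar
      (by exact continuous_inner) hi
  have hFi : Integrable (𝓕 h) := by
    have h1 := (integrable_one_add_norm (E := Sp n) (μ := volume) (r := m)
      (by rw [finrank_euclideanSpace_fin]; linarith)).const_mul (C₁ * B)
    exact h1.mono' hFc.aestronglyMeasurable (Eventually.of_forall (hdecay y h B hh hs hB))
  refine ⟨mul_nonneg (mul_nonneg hD ENNReal.toReal_nonneg) hB0, _, ?_, ?_,
    eq_synth_fourier hh.continuous hi hFi⟩
  · exact (continuous_const.mul (hFc.comp (continuous_const_smul _))).aestronglyMeasurable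
  · have hpt : ∀ ξ : Sp n, ‖(k ξ : ℂ) * (((2 * Real.pi : ℝ) ^ n : ℂ)⁻¹ *
        𝓕 h ((2 * Real.pi)⁻¹ • ξ))‖ ≤ (D * B) * ‖(1 + ‖ξ‖) ^ (-((n : ℝ) + 1))‖ := by
      intro ξ
      have h1 : k ξ ≤ C₀ * k 0 * (1 + ‖ξ‖) ^ N := by
        have := hle ξ 0
        rw [add_zero] at this
        refine this.trans ?_
        rw [mul_assoc, mul_assoc, mul_comm (k 0)]
        refine mul_le_mul_of_nonneg_left (mul_le_mul_of_nonneg_right ?_ (hkpos 0).le) hC₀.le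
        exact Real.rpow_le_rpow (zero_le_one.trans (one_le_bracket ξ)) (bracket_le ξ) hN.le
      have h2 : ‖𝓕 h ((2 * Real.pi)⁻¹ • ξ)‖ ≤
          (2 * Real.pi) ^ m * (C₁ * B) * (1 + ‖ξ‖) ^ (-(m : ℝ)) := by
        have h3 := hF y h B hh hs hB ((2 * Real.pi)⁻¹ • ξ)
        have h4 : (2 * Real.pi)⁻¹ * (1 + ‖ξ‖) ≤ 1 + ‖(2 * Real.pi)⁻¹ • ξ‖ := by
          rw [norm_smul, Real.norm_of_nonneg (by positivity), mul_add, mul_one]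
          gcongr
          refine inv_le_one_of_one_le₀ ?_
          linarith [Real.pi_gt_three]
        rw [Real.rpow_neg (by positivity), Real.rpow_natCast, ← div_eq_mul_inv,
          le_div_iff₀ (by positivity)]
        calc ‖𝓕 h ((2 * Real.pi)⁻¹ • ξ)‖ * (1 + ‖ξ‖) ^ m =
            (2 * Real.pi) ^ m * (((2 * Real.pi)⁻¹ * (1 + ‖ξ‖)) ^ m *
              ‖𝓕 h ((2 * Real.pi)⁻¹ • ξ)‖) := by
              rw [mul_pow (2 * Real.pi)⁻¹, inv_pow, ← mul_assoc, ← mul_assoc,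
                mul_inv_cancel₀ (by positivity), one_mul, mul_comm]
          _ ≤ (2 * Real.pi) ^ m * ((1 + ‖(2 * Real.pi)⁻¹ • ξ‖) ^ m *
              ‖𝓕 h ((2 * Real.pi)⁻¹ • ξ)‖) := by gcongr
          _ ≤ _ := by gcongr
      have h5 : (1 + ‖ξ‖) ^ N * (1 + ‖ξ‖) ^ (-(m : ℝ)) ≤ (1 + ‖ξ‖) ^ (-((n : ℝ) + 1)) := by
        rw [← Real.rpow_add (by positivity)]
        refine Real.rpow_le_rpow_of_exponent_le (by linarith [norm_nonneg ξ]) (by linarith)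
      have hcn : ‖((2 * Real.pi : ℝ) ^ n : ℂ)⁻¹‖ = c := by
        rw [norm_inv, norm_pow, Complex.norm_real, Real.norm_of_nonneg (by positivity)]
      rw [norm_mul, norm_mul, hcn, Complex.norm_real, Real.norm_of_nonneg (hkpos ξ).le,
        Real.norm_of_nonneg (by positivity)]
      calc k ξ * (c * ‖𝓕 h ((2 * Real.pi)⁻¹ • ξ)‖) ≤
          (C₀ * k 0 * (1 + ‖ξ‖) ^ N) * (c * ((2 * Real.pi) ^ m * (C₁ * B) *
            (1 + ‖ξ‖) ^ (-(m : ℝ)))) := by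
            have := (hkpos 0).le
            gcongr
        _ = D * B * ((1 + ‖ξ‖) ^ N * (1 + ‖ξ‖) ^ (-(m : ℝ))) := by simp only [D]; ring
        _ ≤ _ := by gcongr
    refine (eLpNorm_le_mul_eLpNorm_of_ae_le_mul (Eventually.of_forall hpt) 2).trans ?_
    rw [mul_assoc D L B, mul_comm L B, ← mul_assoc,
      ENNReal.ofReal_mul (mul_nonneg hD hB0)]
    refine mul_le_mul_right (le_of_eq ?_) _
    exact (ENNReal.ofReal_toReal (memLp_one_add_norm n).eLpNorm_ne_top).symm

/-! ### Tempered distributions with weighted square integrable Fourier transform -/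

theorem expI_comm (x ξ : Sp n) : expI x ξ = expI ξ x := by
  rw [expI, expI, real_inner_comm]

/-- Fubini and the symmetry of the kernel e^{i⟨x,ξ⟩}. This transposes the synthesis onto a test
function, as in the definition of the Fourier transform of a distribution. -/
theorem integral_synth_mul {a b : Sp n → ℂ} (ha : Integrable a) (hb : Integrable b) :
    ∫ x, synth a x * b x = ∫ ξ, a ξ * synth b ξ := by
  have hint : Integrable (fun p : Sp n × Sp n => expI p.1 p.2 * (b p.1 * a p.2))
      (volume.prod volume) := by
    refine (hb.mul_prod ha).bdd_mul (c := 1) ?_ (Eventually.of_forall fun p => by simp)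
    exact continuous_expI.aestronglyMeasurable
  calc ∫ x, synth a x * b x = ∫ x, ∫ ξ, expI x ξ * (b x * a ξ) := by
        congr 1
        funext x
        rw [synth, ← integral_mul_const]
        congr 1
        funext ξ
        ring
    _ = ∫ ξ, ∫ x, expI x ξ * (b x * a ξ) := integral_integral_swap hint
    _ = ∫ ξ, a ξ * synth b ξ := by
        congr 1
        funext ξ
        rw [synth, ← integral_const_mul]
        congr 1
        funext x
        rw [expI_comm ξ x]
        ring

/-- `HasFourier` describes T only on transforms of Schwartz functions; surjectivity recovers T on
all of 𝒮. -/
theorem exists_fourierS_eq (ψ : 𝓢(Sp n, ℂ)) : ∃ φ : 𝓢(Sp n, ℂ), fourierS φ = ψ := by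
  refine ⟨𝓕⁻ (SchwartzMap.compCLMOfContinuousLinearEquiv ℂ (dilation n).symm ψ), ?_⟩
  rw [fourierS, FourierTransform.fourier_fourierInv_eq]
  ext x
  simp [SchwartzMap.compCLMOfContinuousLinearEquiv_apply]

theorem synth_fourierS (φ : 𝓢(Sp n, ℂ)) (ξ : Sp n) :
    synth (fourierS φ) ξ = ((2 * Real.pi : ℝ) ^ n : ℂ) * φ ξ := by
  have h3 : ((2 * Real.pi : ℝ) ^ n : ℂ) ≠ 0 := by
    apply pow_ne_zero; simp [Real.pi_ne_zero]
  conv_rhs => rw [schwartz_eq_synth φ]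
  rw [synth, synth, ← integral_const_mul]
  congr 1
  funext x
  change _ = ((2 * Real.pi : ℝ) ^ n : ℂ) *
    (expI ξ x * (((2 * Real.pi : ℝ) ^ n : ℂ)⁻¹ * fourierS φ x))
  field_simp

/-- By Fourier inversion T is the function (2π)^{-n} `synth g`, where g is its transform. The strict
inequality lets a suitable g be drawn from the infimum in `bNorm` without proving uniqueness. -/
theorem exists_rep_of_bNorm_lt {k : Sp n → ℝ} (hk : IsL2Weight k) {T : 𝓢'(Sp n, ℂ)} {M : ℝ}
    (hM : 0 ≤ M) (hT : bNorm k T < ENNReal.ofReal M) :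
    ∃ F : Sp n → ℂ, FourierRep k F (((2 * Real.pi) ^ n)⁻¹ * M) ∧
      ∀ ψ : 𝓢(Sp n, ℂ), T ψ = ∫ x, F x * ψ x := by
  simp only [bNorm, iInf_lt_iff] at hT
  obtain ⟨g, hg, hgM⟩ := hT
  have hrep : FourierRep k (synth g) M := ⟨hM, g, hg.1, hgM.le, rfl⟩
  have hgi := hk.integrable hg.1 hgM.le
  have hc : ‖((2 * Real.pi : ℝ) ^ n : ℂ)⁻¹‖ = ((2 * Real.pi) ^ n)⁻¹ := by
    rw [norm_inv, norm_pow, Complex.norm_real, Real.norm_of_nonneg (by positivity)]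
  refine ⟨_, hc ▸ hrep.const_mul ((2 * Real.pi : ℝ) ^ n : ℂ)⁻¹, fun ψ => ?_⟩
  obtain ⟨φ, rfl⟩ := exists_fourierS_eq ψ
  have h3 : ((2 * Real.pi : ℝ) ^ n : ℂ) ≠ 0 := by
    apply pow_ne_zero; simp [Real.pi_ne_zero]
  simp only [mul_assoc]
  rw [(hg.2 φ).2, integral_const_mul, integral_synth_mul hgi (fourierS φ).integrable,
    ← integral_const_mul]
  congr 1
  funext ξ
  rw [synth_fourierS]
  field_simp

theorem bNorm_le_of_rep {k : Sp n → ℝ} (hk : IsL2Weight k) {T : 𝓢'(Sp n, ℂ)} {M : ℝ}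
    {F : Sp n → ℂ} (hF : FourierRep k F M) (hT : ∀ ψ : 𝓢(Sp n, ℂ), T ψ = ∫ x, F x * ψ x) :
    bNorm k T ≤ ENNReal.ofReal ((2 * Real.pi) ^ n * M) := by
  obtain ⟨h0, a, ha, hM, rfl⟩ := hF
  have hai := hk.integrable ha hM
  let c : ℂ := ((2 * Real.pi : ℝ) ^ n : ℂ)
  have hc : ‖c‖ₑ = ENNReal.ofReal ((2 * Real.pi) ^ n) := by
    rw [← ofReal_norm, norm_pow, Complex.norm_real, Real.norm_of_nonneg (by positivity)]
  have hfour : HasFourier T (fun ξ => c * a ξ) := by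
    refine ⟨ha.const_mul c, fun φ => ⟨?_, ?_⟩⟩
    · exact (hai.const_mul c).mul_bdd (c := ‖φ.toBoundedContinuousFunction‖)
        φ.continuous.aestronglyMeasurable
        (Eventually.of_forall fun ξ => φ.toBoundedContinuousFunction.norm_coe_le_norm ξ)
    · rw [hT, integral_synth_mul hai (fourierS φ).integrable]
      congr 1
      funext ξ
      rw [synth_fourierS]
      ring
  refine (iInf₂_le _ hfour).trans ?_
  have : (fun ξ => (k ξ : ℂ) * (c * a ξ)) = c • fun ξ => (k ξ : ℂ) * a ξ := by
    funext ξ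
    simp only [Pi.smul_apply, smul_eq_mul]
    ring
  rw [this, eLpNorm_const_smul, hc, ENNReal.ofReal_mul (by positivity)]
  exact mul_le_mul_right hM _

/-! ### Distributions given by continuous functions -/

/-- A test function as a Schwartz function. -/
def Test.toSchwartz (φ : Test n) : 𝓢(Sp n, ℂ) := φ.hasCompactSupport.toSchwartzMap φ.contDiff

@[simp] theorem Test.toSchwartz_apply (φ : Test n) (x : Sp n) : φ.toSchwartz x = φ x := rfl

theorem ofFun_apply {f : Sp n → ℂ} (hf : Continuous f) (φ : Test n) :
    ofFun f φ = ∫ x, φ x * f x :=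
  TestFunction.integralAgainstBilinCLM_eq_integral (hf.locallyIntegrable.locallyIntegrableOn _)

theorem cutoff_ofFun_apply {f : Sp n → ℂ} (hf : Continuous f) (χ : Test n) (ψ : 𝓢(Sp n, ℂ)) :
    cutoff χ (ofFun f) ψ = ∫ x, (χ x * f x) * ψ x := by
  rw [cutoff_apply, ofFun_apply hf]
  congr 1
  funext x
  rw [mulTest_apply]
  ring

theorem integrable_test_mul {f : Sp n → ℂ} (hf : Continuous f) (φ : Test n) :
    Integrable fun x => φ x * f x :=
  (φ.continuous.mul hf).integrable_of_hasCompactSupport φ.hasCompactSupport.mul_right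

theorem ofFun_sub {f g : Sp n → ℂ} (hf : Continuous f) (hg : Continuous g) :
    ofFun f - ofFun g = ofFun fun x => f x - g x := by
  ext φ
  change ofFun f φ - ofFun g φ = _
  rw [ofFun_apply hf, ofFun_apply hg, ofFun_apply (f := fun x => f x - g x) (hf.sub hg),
    ← integral_sub (integrable_test_mul hf φ) (integrable_test_mul hg φ)]
  congr 1
  funext x
  ring

/-- Continuous functions that agree as distributions are equal. -/
theorem eq_of_forall_integral_test {f g : Sp n → ℂ} (hf : Continuous f) (hg : Continuous g)
    (h : ∀ φ : Test n, ∫ x, φ x * f x = ∫ x, φ x * g x) : f = g := by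
  refine (Continuous.ae_eq_iff_eq volume hf hg).1 ?_
  refine ae_eq_of_integral_contDiff_smul_eq hf.locallyIntegrable hg.locallyIntegrable ?_
  intro φ hφ hφc
  let φ' : Test n :=
    { toFun := fun x => (φ x : ℂ)
      contDiff' := Complex.ofRealCLM.contDiff.comp hφ
      hasCompactSupport' := hφc.comp_left Complex.ofReal_zero
      tsupport_subset' := fun _ _ => trivial }
  simp only [Complex.real_smul]
  exact h φ'

theorem translate_apply (y : Sp n) (χ : Test n) (x : Sp n) : translate y χ x = χ (x - y) := rfl

/-- The function representing χ(· - y) f as a distribution is continuous, so it is that product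
itself. With `ulNorm_le_of_rep` this translates between `ulNorm` and `FourierRep` bounds uniform in
y. -/
theorem rep_of_ulNorm_lt {k : Sp n → ℝ} (hk : IsL2Weight k) {f : Sp n → ℂ} (hf : Continuous f)
    {χ : Test n} {M : ℝ} (hM : 0 ≤ M) (h : ulNorm k χ (ofFun f) < ENNReal.ofReal M) (y : Sp n) :
    FourierRep k (fun x => χ (x - y) * f x) (((2 * Real.pi) ^ n)⁻¹ * M) := by
  obtain ⟨F, hF, hFψ⟩ := exists_rep_of_bNorm_lt hk hM ((le_iSup _ y).trans_lt h)
  have : F = fun x => χ (x - y) * f x := by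
    refine eq_of_forall_integral_test (hF.continuous hk)
      ((χ.continuous.comp (continuous_id.sub continuous_const)).mul hf) fun φ => ?_
    have h1 := hFψ φ.toSchwartz
    rw [cutoff_ofFun_apply hf] at h1
    simp only [Test.toSchwartz_apply, translate_apply] at h1
    simp only [mul_comm (φ _)]
    exact h1.symm
  rwa [this] at hF

theorem ulNorm_le_of_rep {k : Sp n → ℝ} (hk : IsL2Weight k) {f : Sp n → ℂ} (hf : Continuous f)
    {χ : Test n} {M : ℝ} (h : ∀ y, FourierRep k (fun x => χ (x - y) * f x) M) :
    ulNorm k χ (ofFun f) ≤ ENNReal.ofReal ((2 * Real.pi) ^ n * M) :=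
  iSup_le fun y => bNorm_le_of_rep hk (h y) (cutoff_ofFun_apply hf (translate y χ))

/-! ### Changing the window -/

theorem exists_apply_ne_zero {χ : Test n} (hχ : χ ≠ 0) : ∃ x₀, χ x₀ ≠ 0 := by
  by_contra! h
  exact hχ (TestFunction.ext fun x => by simpa using h x)

/-- Every test function is a finite sum of products of translates of a fixed nonzero test function
and of test functions. -/
theorem exists_eq_sum_translate_mul {χ : Test n} (hχ : χ ≠ 0) (φ : Test n) :
    ∃ (s : Finset (Sp n)) (ψ : Sp n → Test n), ∀ x, φ x = ∑ y ∈ s, χ (x - y) * ψ y x := by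
  obtain ⟨x₀, hx₀⟩ := exists_apply_ne_zero hχ
  have hc : ∀ y, Continuous fun x : Sp n => χ (x - y) := fun y =>
    χ.continuous.comp (continuous_id.sub continuous_const)
  obtain ⟨s, hs⟩ := φ.hasCompactSupport.isCompact.elim_finite_subcover
    (fun y => {x : Sp n | χ (x - y) ≠ 0}) (fun y => isOpen_ne_fun (hc y) continuous_const)
    (fun x _ => Set.mem_iUnion.2 ⟨x - x₀, by simpa using hx₀⟩)
  -- S = ∑ |χ(· - y)|² has no zero on the support of φ, by the choice of the finite cover. So φ = ∑
  -- χ(· - y) · φ conj(χ(· - y)) / S; elsewhere the quotient is multiplied by φ = 0.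
  let S : Sp n → ℂ := fun x => ∑ y ∈ s, starRingEnd ℂ (χ (x - y)) * χ (x - y)
  have hχs : ∀ y, ContDiff ℝ ∞ fun x : Sp n => χ (x - y) := fun y =>
    χ.contDiff.comp (contDiff_id.sub contDiff_const)
  have hχs' : ∀ y, ContDiff ℝ ∞ fun x : Sp n => starRingEnd ℂ (χ (x - y)) := fun y =>
    (Complex.conjCLE : ℂ →L[ℝ] ℂ).contDiff.comp (hχs y)
  have hS : ContDiff ℝ ∞ S := ContDiff.sum fun y _ => (hχs' y).mul (hχs y)
  have hS0 : ∀ x ∈ tsupport φ, S x ≠ 0 := by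
    intro x hx h0
    have h1 : S x = ((∑ y ∈ s, ‖χ (x - y)‖ ^ 2 : ℝ) : ℂ) := by
      simp only [S, Complex.ofReal_sum]
      refine Finset.sum_congr rfl fun y _ => ?_
      rw [mul_comm, Complex.mul_conj, Complex.normSq_eq_norm_sq]
    rw [h1, Complex.ofReal_eq_zero, Finset.sum_eq_zero_iff_of_nonneg fun _ _ => by positivity] at h0
    obtain ⟨y, hy, hxy⟩ := Set.mem_iUnion₂.1 (hs hx)
    exact hxy (by simpa using h0 y hy)
  let ψ : Sp n → Test n := fun y =>
    { toFun := fun x => φ x * (starRingEnd ℂ (χ (x - y)) * (S x)⁻¹)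
      contDiff' := by
        refine contDiff_iff_contDiffAt.2 fun x => ?_
        by_cases hx : x ∈ tsupport φ
        · exact φ.contDiff.contDiffAt.mul ((hχs' y).contDiffAt.mul (hS.contDiffAt.inv (hS0 x hx)))
        · refine contDiffAt_const (c := (0 : ℂ)) |>.congr_of_eventuallyEq ?_
          filter_upwards [(isClosed_tsupport φ).isOpen_compl.mem_nhds hx] with z hz
          rw [image_eq_zero_of_notMem_tsupport hz, zero_mul]
      hasCompactSupport' := φ.hasCompactSupport.mul_right
      tsupport_subset' := fun _ _ => trivial }
  refine ⟨s, ψ, fun x => ?_⟩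
  change φ x = ∑ y ∈ s, χ (x - y) * (φ x * (starRingEnd ℂ (χ (x - y)) * (S x)⁻¹))
  have h2 : ∑ y ∈ s, χ (x - y) * (φ x * (starRingEnd ℂ (χ (x - y)) * (S x)⁻¹)) =
      φ x * (S x * (S x)⁻¹) := by
    simp only [S, Finset.sum_mul, Finset.mul_sum]
    refine Finset.sum_congr rfl fun y _ => ?_
    ring
  rw [h2]
  by_cases hx : x ∈ tsupport φ
  · rw [mul_inv_cancel₀ (hS0 x hx), mul_one]
  · rw [image_eq_zero_of_notMem_tsupport hx, zero_mul]

/-- With χ' = ∑ χ(· - z) ψ_z, the product χ'(· - y) f is a finite sum of terms ψ_z(· - y) · χ(· - (y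
+ z)) f, and multiplication by ψ_z(· - y) is bounded uniformly in y. Hence the space does not depend
on the window. -/
theorem exists_rep_window {k : Sp n → ℝ} (hk : IsL2Weight k) (hpol : IsKpol k) {χ : Test n}
    (hχ : χ ≠ 0) (χ' : Test n) : ∃ C : ℝ, 0 ≤ C ∧ ∀ (f : Sp n → ℂ) (M : ℝ),
      (∀ y, FourierRep k (fun x => χ (x - y) * f x) M) →
        ∀ y, FourierRep k (fun x => χ' (x - y) * f x) (C * M) := by
  obtain ⟨s, ψ, hψ⟩ := exists_eq_sum_translate_mul hχ χ'
  choose C hC hCψ using fun y => exists_rep_schwartz_mul hk hpol (ψ y).toSchwartz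
  refine ⟨∑ y ∈ s, C y, Finset.sum_nonneg fun y _ => hC y, fun f M hf y => ?_⟩
  have := FourierRep.sum hk s (f := fun z x => ψ z (x - y) * (χ (x - (y + z)) * f x))
    (M := fun z => C z * M) fun z _ => hCψ z _ M (hf (y + z)) y
  rw [← Finset.sum_mul] at this
  convert this using 1
  funext x
  rw [hψ, Finset.sum_mul]
  refine Finset.sum_congr rfl fun z _ => ?_
  rw [sub_sub]
  ring

/-! ### Elements of `ℬ_k^∞` are continuous functions -/

/-- Each χ(· - y) u is a continuous function F_y. These satisfy χ(· - z) F_y = χ(· - y) F_z, so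
dividing by the window gives one function, independent of y. -/
theorem exists_continuous_eq_ofFun {k : Sp n → ℝ} (hk : IsL2Weight k) {u : Distr n}
    (hu : MemBInf k u) : ∃ f : Sp n → ℂ, Continuous f ∧ u = ofFun f := by
  obtain ⟨χ, hχ, hfin⟩ := hu
  obtain ⟨x₀, hx₀⟩ := exists_apply_ne_zero hχ
  have hb : ∀ y, bNorm k (cutoff (translate y χ) u) <
      ENNReal.ofReal ((ulNorm k χ u).toReal + 1) := by
    intro y
    refine (le_iSup (fun y => bNorm k (cutoff (translate y χ) u)) y).trans_lt ?_
    change ulNorm k χ u < _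
    rw [ENNReal.ofReal_add ENNReal.toReal_nonneg zero_le_one, ENNReal.ofReal_toReal hfin.ne]
    simpa using ENNReal.lt_add_right hfin.ne one_ne_zero
  choose F hF hFu using fun y => exists_rep_of_bNorm_lt hk (by positivity) (hb y)
  have hFc : ∀ y, Continuous (F y) := fun y => (hF y).continuous hk
  have hχc : ∀ y, Continuous fun x : Sp n => χ (x - y) := fun y =>
    χ.continuous.comp (continuous_id.sub continuous_const)
  have hcons : ∀ y z x, χ (x - z) * F y x = χ (x - y) * F z x := by
    intro y z
    refine congrFun (eq_of_forall_integral_test ((hχc z).mul (hFc y)) ((hχc y).mul (hFc z))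
      fun φ => ?_)
    have h1 : ∀ y z, ∫ x, φ x * (χ (x - z) * F y x) =
        u (mulTest (translate y χ) (mulTest (translate z χ) φ.toSchwartz).toSchwartz) := by
      intro y z
      rw [← cutoff_apply, hFu]
      congr 1
      funext x
      rw [Test.toSchwartz_apply, mulTest_apply, translate_apply, Test.toSchwartz_apply]
      ring
    rw [h1, h1]
    congr 1
    ext x
    simp only [mulTest_apply, Test.toSchwartz_apply]
    ring
  -- The window translated by x - x₀ takes the value χ(x₀) ≠ 0 at x.
  let f : Sp n → ℂ := fun x => F (x - x₀) x / χ x₀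
  have hfF : ∀ y x, χ (x - y) * f x = F y x := by
    intro y x
    have := hcons y (x - x₀) x
    rw [sub_sub_cancel] at this
    simp only [f]
    rw [← mul_div_assoc, ← this, mul_div_cancel_left₀ _ hx₀]
  -- The window in the definition of f moves with the point; near a given x the single window y = x
  -- - x₀ serves.
  have hfc : Continuous f := by
    refine continuous_iff_continuousAt.2 fun x => ?_
    have h1 : χ (x - (x - x₀)) ≠ 0 := by rwa [sub_sub_cancel]
    have h2 : ContinuousAt (fun z => F (x - x₀) z / χ (z - (x - x₀))) x :=
      (hFc _).continuousAt.div (hχc _).continuousAt h1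
    refine h2.congr ?_
    filter_upwards [(hχc (x - x₀)).continuousAt.eventually_ne h1] with z hz
    rw [← hfF, mul_div_cancel_left₀ _ hz]
  refine ⟨f, hfc, ?_⟩
  ext φ
  obtain ⟨s, ψ, hψ⟩ := exists_eq_sum_translate_mul hχ φ
  have hφ : φ = ∑ y ∈ s, mulTest (translate y χ) (ψ y).toSchwartz := by
    ext x
    have h1 : (∑ y ∈ s, mulTest (translate y χ) (ψ y).toSchwartz) x =
        ∑ y ∈ s, mulTest (translate y χ) (ψ y).toSchwartz x := by
      induction s using Finset.cons_induction with
      | empty => simp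
      | cons a s ha ih => simp_all
    rw [h1, hψ]
    rfl
  rw [hφ, map_sum, map_sum]
  refine Finset.sum_congr rfl fun y _ => ?_
  rw [← cutoff_apply, ← cutoff_apply, hFu, cutoff_ofFun_apply hfc]
  simp only [translate_apply, hfF]

/-! ### Neumann series -/

section Neumann

variable {k : Sp n → ℝ} {K : ℝ} {ι : Type*} {w w' : ι → Sp n → ℂ} {δ : ℝ}

/-- Neumann series: e wᵐ has norm at most M 2⁻ᵐ because K δ ≤ 1/2, so the partial sums are bounded
by 2M and converge pointwise. The factor e is carried along because the constant 1 need not belong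
to the algebra. -/
theorem FourierRep.mul_inv_one_sub (hk : IsL2Weight k) (hK : 0 ≤ K)
    (hmul : ∀ (f g : Sp n → ℂ) (M N : ℝ), FourierRep k f M → FourierRep k g N →
      FourierRep k (fun x => f x * g x) (K * M * N))
    {e w : Sp n → ℂ} {M δ : ℝ} (he : FourierRep k e M) (hw : FourierRep k w δ)
    (hδ : K * δ ≤ 1 / 2) (hw1 : ∀ x, ‖w x‖ < 1) :
    FourierRep k (fun x => e x * (1 - w x)⁻¹) (2 * M) := by
  have hM := he.nonneg
  have hKδ : 0 ≤ K * δ := mul_nonneg hK hw.nonneg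
  have hpow : ∀ m : ℕ, FourierRep k (fun x => e x * w x ^ m) (M * (1 / 2) ^ m) := by
    intro m
    induction m with
    | zero => simpa using he
    | succ m ih =>
      have h1 := hmul _ _ _ _ ih hw
      simp only [pow_succ, ← mul_assoc]
      refine h1.mono ?_
      calc K * (M * (1 / 2) ^ m) * δ = M * (1 / 2) ^ m * (K * δ) := by ring
        _ ≤ M * (1 / 2) ^ m * (1 / 2) := by gcongr
  have hpart : ∀ N : ℕ, FourierRep k (fun x => ∑ m ∈ Finset.range N, e x * w x ^ m) (2 * M) := by
    intro N
    refine (FourierRep.sum hk (Finset.range N) fun m _ => hpow m).mono ?_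
    rw [← Finset.mul_sum, mul_comm]
    refine mul_le_mul_of_nonneg_right ?_ hM
    have := sum_le_hasSum (Finset.range N) (fun m _ => by positivity) hasSum_geometric_two
    simpa using this
  refine FourierRep.of_tendsto hk (l := atTop) hpart fun x => ?_
  exact ((hasSum_geometric_of_norm_lt_one (hw1 x)).mul_left (e x)).tendsto_sum_nat

theorem FourierRep.mul_prod_inv_one_sub (hk : IsL2Weight k) (hK : 0 ≤ K)
    (hmul : ∀ (f g : Sp n → ℂ) (M N : ℝ), FourierRep k f M → FourierRep k g N →
      FourierRep k (fun x => f x * g x) (K * M * N))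
    {e : Sp n → ℂ} {M : ℝ} (he : FourierRep k e M)
    (hw : ∀ j, FourierRep k (w j) δ) (hδ : K * δ ≤ 1 / 2) (hw1 : ∀ j x, ‖w j x‖ < 1)
    (s : Finset ι) :
    FourierRep k (fun x => e x * ∏ j ∈ s, (1 - w j x)⁻¹) (2 ^ s.card * M) := by
  classical
  induction s using Finset.induction_on with
  | empty => simpa using he
  | insert i s hi ih =>
    have := ih.mul_inv_one_sub hk hK hmul (hw i) hδ (hw1 i)
    rw [Finset.card_insert_of_notMem hi, pow_succ']
    simp only [Finset.prod_insert hi]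
    convert this using 1
    · funext x; ring
    · ring

/-- Telescoping, one factor at a time, with (1-w)⁻¹ - (1-w')⁻¹ = (w-w')(1-w)⁻¹(1-w')⁻¹. What matters
is that the bound is linear in η. -/
theorem FourierRep.mul_prod_inv_one_sub_sub (hk : IsL2Weight k) (hK : 0 ≤ K)
    (hmul : ∀ (f g : Sp n → ℂ) (M N : ℝ), FourierRep k f M → FourierRep k g N →
      FourierRep k (fun x => f x * g x) (K * M * N))
    {e : Sp n → ℂ} {M η : ℝ} (he : FourierRep k e M)
    (hw : ∀ j, FourierRep k (w j) δ) (hw' : ∀ j, FourierRep k (w' j) δ) (hδ : K * δ ≤ 1 / 2)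
    (hw1 : ∀ j x, ‖w j x‖ < 1) (hw1' : ∀ j x, ‖w' j x‖ < 1)
    (hη : ∀ j, FourierRep k (fun x => w j x - w' j x) η) (s : Finset ι) :
    FourierRep k (fun x => e x * (∏ j ∈ s, (1 - w j x)⁻¹ - ∏ j ∈ s, (1 - w' j x)⁻¹))
      (2 * s.card * 2 ^ s.card * (K * M * η)) := by
  classical
  induction s using Finset.induction_on with
  | empty => simpa using FourierRep.zero k
  | insert i s hi ih =>
    have h1 := ih.mul_inv_one_sub hk hK hmul (hw i) hδ (hw1 i)
    have h2 := (((hmul _ _ _ _ he (hη i)).mul_inv_one_sub hk hK hmul (hw i) hδ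
      (hw1 i)).mul_inv_one_sub hk hK hmul (hw' i) hδ (hw1' i)).mul_prod_inv_one_sub hk hK hmul
      hw' hδ hw1' s
    have hne : ∀ z : ℂ, ‖z‖ < 1 → 1 - z ≠ 0 := fun z hz h0 => by
      rw [sub_eq_zero] at h0
      rw [← h0, norm_one] at hz
      exact lt_irrefl _ hz
    rw [Finset.card_insert_of_notMem hi]
    simp only [Finset.prod_insert hi]
    convert h1.add hk h2 using 1
    · funext x
      have e1 := hne _ (hw1 i x)
      have e2 := hne _ (hw1' i x)
      have e3 : (1 - w i x)⁻¹ - (1 - w' i x)⁻¹ =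
          (w i x - w' i x) * (1 - w i x)⁻¹ * (1 - w' i x)⁻¹ := by
        field_simp
        ring
      linear_combination (e x * ∏ j ∈ s, (1 - w' j x)⁻¹) * e3
    · push_cast
      ring

end Neumann

/-! ### Band-limited functions -/

/-- A vector valued function with frequencies in the ball of radius `R` is smooth, with bounds for
its derivatives. -/
theorem contDiff_synth_of_support {d : ℕ} {R : ℝ} (b : Sp n → Fin d → ℂ)
    (hb : Integrable b) (hsupp : ∀ ξ, R < ‖ξ‖ → b ξ = 0) (m : ℕ) :
    ContDiff ℝ m (fun x j => synth (fun ξ => b ξ j) x) ∧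
      ∀ i ≤ m, ∀ x, ‖iteratedFDeriv ℝ i (fun x j => synth (fun ξ => b ξ j) x) x‖ ≤
        R ^ i * ∫ ξ, ‖b ξ‖ := by
  -- This scaling turns the character e^{-2πi⟨·,·⟩} into e^{i⟨x,ξ⟩}. As 2π‖Λ‖ ≤ 1, each derivative
  -- costs just a factor R.
  let Λ : Sp n →L[ℝ] Sp n →L[ℝ] ℝ := (-(2 * Real.pi)⁻¹ : ℝ) • innerSL ℝ
  have hΛa : ∀ ξ x, Λ ξ x = -(2 * Real.pi)⁻¹ * inner ℝ ξ x := fun ξ x => rfl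
  have hΛ : ‖Λ‖ ≤ (2 * Real.pi)⁻¹ := by
    refine ContinuousLinearMap.opNorm_le_bound₂ Λ (by positivity) fun ξ x => ?_
    rw [hΛa, norm_mul, norm_neg, Real.norm_of_nonneg (by positivity), mul_assoc]
    exact mul_le_mul_of_nonneg_left (norm_inner_le_norm ξ x) (by positivity)
  have heq : (fun x j => synth (fun ξ => b ξ j) x) =
      VectorFourier.fourierIntegral Real.fourierChar volume Λ.toLinearMap₁₂ b := by
    funext x j
    rw [VectorFourier.fourierIntegral]
    have hchar : ∀ ξ, (Real.fourierChar (-(Λ.toLinearMap₁₂ ξ x)) : ℂ) = expI x ξ := by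
      intro ξ
      have : Λ.toLinearMap₁₂ ξ x = -(2 * Real.pi)⁻¹ * inner ℝ ξ x := hΛa ξ x
      rw [this, Real.fourierChar_apply, expI, real_inner_comm]
      congr 1
      have h : (Real.pi : ℂ) ≠ 0 := by exact_mod_cast Real.pi_ne_zero
      push_cast
      field_simp
    have hi : Integrable (fun ξ => Real.fourierChar (-(Λ.toLinearMap₁₂ ξ x)) • b ξ) := by
      refine (VectorFourier.fourierIntegral_convergent_iff Real.continuous_fourierChar ?_ x).2 hb
      exact Λ.continuous₂
    have h1 := (ContinuousLinearMap.proj (R := ℂ) (φ := fun _ : Fin d => ℂ) j).integral_comp_comm hi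
    refine Eq.trans ?_ h1
    rw [synth]
    congr 1
    funext ξ
    simp only [ContinuousLinearMap.proj_apply, Pi.smul_apply, Circle.smul_def, hchar, smul_eq_mul]
  have hmom : ∀ i : ℕ, Integrable (fun ξ => ‖ξ‖ ^ i * ‖b ξ‖) ∧
      ∀ ξ, ‖ξ‖ ^ i * ‖b ξ‖ ≤ R ^ i * ‖b ξ‖ := by
    intro i
    have hle : ∀ ξ, ‖ξ‖ ^ i * ‖b ξ‖ ≤ R ^ i * ‖b ξ‖ := by
      intro ξ
      by_cases hξ : R < ‖ξ‖
      · simp [hsupp ξ hξ]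
      · gcongr
        exact not_lt.1 hξ
    refine ⟨(hb.norm.const_mul (R ^ i)).mono' ?_ (Eventually.of_forall fun ξ => ?_), hle⟩
    · exact (by fun_prop : Continuous fun ξ : Sp n => ‖ξ‖ ^ i).aestronglyMeasurable.mul
        hb.aestronglyMeasurable.norm
    · rw [Real.norm_of_nonneg (by positivity)]
      exact hle ξ
  rw [heq]
  refine ⟨?_, fun i hi x => ?_⟩
  · exact VectorFourier.contDiff_fourierIntegral Λ (N := (m : ℕ∞)) fun i _ => (hmom i).1
  · rw [VectorFourier.iteratedFDeriv_fourierIntegral Λ (N := (m : ℕ∞)) (fun i _ => (hmom i).1)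
      hb.aestronglyMeasurable (by exact_mod_cast hi)]
    refine (VectorFourier.norm_fourierIntegral_le_integral_norm _ _ _ _ _).trans ?_
    rw [← integral_const_mul]
    refine integral_mono_of_nonneg (Eventually.of_forall fun ξ => norm_nonneg _)
      (hb.norm.const_mul _) (Eventually.of_forall fun ξ => ?_)
    refine (VectorFourier.norm_fourierPowSMulRight_le Λ b ξ i).trans ?_
    have h2 : (2 * Real.pi * ‖Λ‖) ^ i ≤ 1 := by
      refine pow_le_one₀ (by positivity) ?_
      calc 2 * Real.pi * ‖Λ‖ ≤ 2 * Real.pi * (2 * Real.pi)⁻¹ := by gcongr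
        _ = 1 := mul_inv_cancel₀ (by positivity)
    rw [mul_assoc]
    exact (mul_le_of_le_one_left (by positivity) h2).trans ((hmom i).2 ξ)

theorem exists_bound_iteratedFDeriv {E : Type*} [NormedAddCommGroup E] [NormedSpace ℝ E]
    {h : E → ℂ} {m : ℕ} (hh : ContDiff ℝ m h) (hc : HasCompactSupport h) :
    ∃ B : ℝ, 0 ≤ B ∧ ∀ i ≤ m, ∀ x, ‖iteratedFDeriv ℝ i h x‖ ≤ B := by
  have h1 : ∀ i : ℕ, ∃ B : ℝ, 0 ≤ B ∧ (i ≤ m → ∀ x, ‖iteratedFDeriv ℝ i h x‖ ≤ B) := by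
    intro i
    by_cases hi : i ≤ m
    · obtain ⟨B, hB⟩ := (hc.iteratedFDeriv (𝕜 := ℝ) i).exists_bound_of_continuous
        (hh.continuous_iteratedFDeriv (by exact_mod_cast hi))
      exact ⟨B, (norm_nonneg _).trans (hB 0), fun _ => hB⟩
    · exact ⟨0, le_rfl, fun h => absurd h hi⟩
  choose B hB0 hB using h1
  refine ⟨∑ i ∈ Finset.range (m + 1), B i, Finset.sum_nonneg fun i _ => hB0 i, fun i hi x => ?_⟩
  exact (hB i hi x).trans (Finset.single_le_sum (f := B) (fun j _ => hB0 j)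
    (Finset.mem_range.2 (by omega)))

/-- Compositions of a compactly supported smooth function with functions that have bounded
derivatives, multiplied by translates of a test function. -/
theorem exists_rep_test_mul_comp {k : Sp n → ℝ} (hpol : IsKpol k) (χ : Test n) {d : ℕ}
    {G : (Fin d → ℂ) → ℂ} (hG : ∀ m : ℕ, ContDiff ℝ m G) (hGc : HasCompactSupport G) {D : ℝ}
    (hD : 1 ≤ D) :
    ∃ (m : ℕ) (M : ℝ), 0 ≤ M ∧ ∀ (y : Sp n) (c : Fin d → ℂ) (v : Sp n → Fin d → ℂ),
      ContDiff ℝ m v → (∀ i, 1 ≤ i → i ≤ m → ∀ x, ‖iteratedFDeriv ℝ i v x‖ ≤ D ^ i) →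
      FourierRep k (fun x => χ (x - y) * G (v x + c)) M := by
  obtain ⟨ρ, hρ⟩ := χ.hasCompactSupport.isCompact.isBounded.subset_closedBall (0 : Sp n)
  obtain ⟨m, C, hC, hrep⟩ := exists_rep_of_contDiff hpol ρ
  have hχm : ContDiff ℝ m χ := χ.contDiff.of_le (by exact_mod_cast le_top)
  obtain ⟨Bχ, hBχ, hχB⟩ := exists_bound_iteratedFDeriv hχm χ.hasCompactSupport
  obtain ⟨BG, hBG, hGB⟩ := exists_bound_iteratedFDeriv (hG m) hGc
  -- The bound l! · BG · D^l for derivatives of a composite, with l ≤ m and D ≥ 1. It uses no bound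
  -- on v itself, and translating G by c does not affect it.
  let Q : ℝ := m.factorial * BG * D ^ m
  have hQ : 0 ≤ Q := by positivity
  refine ⟨m, C * (2 ^ m * (Bχ * Q)), by positivity, fun y c v hv hvD => hrep y _ _ ?_ ?_ ?_⟩
  · exact (hχm.comp (contDiff_id.sub contDiff_const)).mul
      ((hG m).comp (hv.add contDiff_const))
  · intro x hx
    have : x - y ∉ tsupport χ := fun h => hx (by simpa [dist_eq_norm] using hρ h)
    rw [image_eq_zero_of_notMem_tsupport this, zero_mul]
  · intro i hi x
    have hGc' : ContDiff ℝ m (fun z => G (z + c)) := (hG m).comp (contDiff_id.add contDiff_const)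
    have hcomp : ∀ l ≤ m, ‖iteratedFDeriv ℝ l (fun x => G (v x + c)) x‖ ≤ Q := by
      intro l hl
      have h1 := norm_iteratedFDeriv_comp_le hGc' hv (n := l) (by exact_mod_cast hl) x
        (C := BG) (D := D) (fun i hi => by
          rw [iteratedFDeriv_comp_add_right]
          exact hGB i (hi.trans hl) _) (fun i h1 hi => hvD i h1 (hi.trans hl) x)
      refine h1.trans ?_
      have h2 : (l.factorial : ℝ) ≤ m.factorial := by exact_mod_cast Nat.factorial_le hl
      have h3 : D ^ l ≤ D ^ m := pow_le_pow_right₀ hD hl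
      simp only [Q]
      gcongr
    refine (norm_iteratedFDeriv_mul_le (N := (m : ℕ∞ω))
      (hχm.comp (contDiff_id.sub contDiff_const)) ((hG m).comp (hv.add contDiff_const)) x
      (by exact_mod_cast hi)).trans ?_
    calc _ ≤ ∑ l ∈ Finset.range (i + 1), (i.choose l : ℝ) * (Bχ * Q) := by
          refine Finset.sum_le_sum fun l hl => ?_
          have hl' : l ≤ i := by simpa [Nat.lt_succ_iff] using hl
          rw [mul_assoc]
          refine mul_le_mul_of_nonneg_left ?_ (by positivity)
          refine mul_le_mul ?_ (hcomp _ ((Nat.sub_le _ _).trans hi)) (norm_nonneg _) hBχ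
          have := iteratedFDeriv_comp_sub (𝕜 := ℝ) (f := χ) l y x
          change ‖iteratedFDeriv ℝ l (fun z => χ (z - y)) x‖ ≤ Bχ
          rw [this]
          exact hχB l (hl'.trans hi) _
      _ = 2 ^ i * (Bχ * Q) := by
          rw [← Finset.sum_mul]
          congr 1
          exact_mod_cast Nat.sum_range_choose i
      _ ≤ 2 ^ m * (Bχ * Q) := by
          gcongr
          norm_num

/-- Near a compact subset of its domain, a holomorphic function agrees with a smooth function of
compact support. -/
theorem exists_smooth_compactSupport_eq {d : ℕ} {Ω S : Set (Fin d → ℂ)} (hΩ : IsOpen Ω)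
    {Φ : (Fin d → ℂ) → ℂ} (hΦ : DifferentiableOn ℂ Φ Ω) (hS : IsCompact S) (hSΩ : S ⊆ Ω) :
    ∃ r > 0, ∃ G : (Fin d → ℂ) → ℂ, (∀ m : ℕ, ContDiff ℝ m G) ∧ HasCompactSupport G ∧
      ∀ p ∈ S, ∀ z, dist z p ≤ 2 * r → z ∈ Ω ∧ G z = Φ z := by
  -- The cutoff κ is 1 near the closed R/2-neighbourhood of S and 0 off the closed R-neighbourhood,
  -- which lies in Ω. Hence r = R/4, so that 2r = R/2.
  obtain ⟨R, hR, hRΩ⟩ := hS.exists_cthickening_subset_open hΩ hSΩ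
  have hcpt : IsCompact (Metric.cthickening R S) := hS.cthickening
  have hsub : Metric.cthickening (R / 2) S ⊆ interior (Metric.cthickening R S) :=
    (Metric.cthickening_subset_thickening' hR (by linarith) S).trans
      (interior_maximal (Metric.thickening_subset_cthickening R S) Metric.isOpen_thickening)
  obtain ⟨κ, hκ1, hκ0, -⟩ := exists_contMDiffMap_one_nhds_of_subset_interior
    (n := ⊤) (modelWithCornersSelf ℝ (Fin d → ℂ)) Metric.isClosed_cthickening hsub
  have hκ : ContDiff ℝ ∞ κ := κ.contMDiff.contDiff
  refine ⟨R / 4, by positivity, fun z => (κ z : ℂ) * Φ z, fun m => ?_, ?_, fun p hp z hz => ?_⟩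
  · refine contDiff_iff_contDiffAt.2 fun z => ?_
    by_cases hz : z ∈ Metric.cthickening R S
    · refine ContDiffAt.mul ?_ ?_
      · exact (Complex.ofRealCLM.contDiff.comp (hκ.of_le (by exact_mod_cast le_top))).contDiffAt
      · exact ((contDiffOn_of_differentiableOn hΩ hΦ m).contDiffAt
          (hΩ.mem_nhds (hRΩ hz))).restrict_scalars ℝ
    · refine (contDiffAt_const (c := (0 : ℂ))).congr_of_eventuallyEq ?_
      filter_upwards [Metric.isClosed_cthickening.isOpen_compl.mem_nhds hz] with x hx
      rw [hκ0 x hx, Complex.ofReal_zero, zero_mul]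
  · refine HasCompactSupport.of_support_subset_isCompact hcpt fun z hz => ?_
    by_contra hz'
    exact hz (by simp only [hκ0 z hz', Complex.ofReal_zero, zero_mul])
  · have h1 : z ∈ Metric.cthickening (R / 2) S :=
      Metric.mem_cthickening_of_dist_le z p _ S hp (by linarith)
    refine ⟨hRΩ (interior_subset (hsub h1)), ?_⟩
    simp only
    rw [hκ1.self_of_nhdsSet z h1, Complex.ofReal_one, one_mul]

/-! ### The composition estimate -/

/-- Truncation of frequencies: if `k'/k → 0`, then functions in the space with weight `k` are
approximated in the space with weight `k'` by band-limited functions. -/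
theorem exists_truncation {k k' : Sp n → ℝ} (hk : IsL2Weight k) (hk' : IsL2Weight k')
    (hlim : Tendsto (fun ξ => k' ξ / k ξ) (cocompact (Sp n)) (𝓝 0)) (d : ℕ) {M δ : ℝ}
    (hM : 0 ≤ M) (hδ : 0 < δ) :
    ∃ D : ℝ, 1 ≤ D ∧ ∀ h : Sp n → Fin d → ℂ, (∀ j, FourierRep k (fun x => h x j) M) →
      ∃ v : Sp n → Fin d → ℂ, (∀ m : ℕ, ContDiff ℝ m v) ∧
        (∀ i, 1 ≤ i → ∀ x, ‖iteratedFDeriv ℝ i v x‖ ≤ D ^ i) ∧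
        ∀ j, FourierRep k' (fun x => h x j - v x j) δ := by
  have hs : 0 < δ / (M + 1) := by positivity
  -- Above frequency R the weight k' is a small multiple of k. The radius depends only on δ and M,
  -- so it serves every h in the ball; M + 1 avoids a zero denominator.
  obtain ⟨R, hR0, hR⟩ : ∃ R : ℝ, 0 ≤ R ∧ ∀ ξ, R < ‖ξ‖ → k' ξ ≤ δ / (M + 1) * k ξ := by
    obtain ⟨R, hR⟩ := Metric.closedBall_compl_subset_of_mem_cocompact
      (hlim.eventually (gt_mem_nhds hs)) (0 : Sp n)
    refine ⟨max R 0, le_max_right _ _, fun ξ hξ => ?_⟩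
    have : ξ ∈ (Metric.closedBall (0 : Sp n) R)ᶜ := by
      simpa using (le_max_left R 0).trans_lt hξ
    have h1 : k' ξ / k ξ < δ / (M + 1) := hR this
    exact ((div_lt_iff₀ (hk.pos ξ)).1 h1).le
  let A : ℝ := d * (invNorm k * M)
  have hA : 0 ≤ A := mul_nonneg (Nat.cast_nonneg d) (mul_nonneg (invNorm_nonneg k) hM)
  -- A bounds the L¹ norm of the truncated coefficients, so the i-th derivative is at most R^i A.
  -- For i ≥ 1 one has A ≤ (A + 1)^i, which gives the form D^i.
  refine ⟨(R + 1) * (A + 1), by nlinarith, fun h hh => ?_⟩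
  choose a ham haM hah using fun j => (hh j).exists_measurable
  have hai : ∀ j, Integrable (a j) := fun j => hk.integrable (ham j).aestronglyMeasurable (haM j)
  let s : Set (Sp n) := Metric.closedBall 0 R
  have hsm : MeasurableSet s := measurableSet_closedBall
  let b : Sp n → Fin d → ℂ := fun ξ j => s.indicator (a j) ξ
  have hbi : Integrable b := Integrable.of_eval fun j => (hai j).indicator hsm
  have hbn : ∫ ξ, ‖b ξ‖ ≤ A := by
    calc ∫ ξ, ‖b ξ‖ ≤ ∫ ξ, ∑ j, ‖a j ξ‖ := by
          refine integral_mono_of_nonneg (Eventually.of_forall fun ξ => norm_nonneg _)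
            (integrable_finsetSum _ fun j _ => (hai j).norm) (Eventually.of_forall fun ξ => ?_)
          refine (pi_norm_le_iff_of_nonneg (Finset.sum_nonneg fun j _ => norm_nonneg _)).2
            fun j => ?_
          exact (norm_indicator_le_norm_self _ _).trans
            (Finset.single_le_sum (f := fun j => ‖a j ξ‖) (fun j _ => norm_nonneg _)
              (Finset.mem_univ j))
      _ = ∑ j, ∫ ξ, ‖a j ξ‖ := integral_finsetSum _ fun j _ => (hai j).norm
      _ ≤ ∑ _j : Fin d, invNorm k * M := Finset.sum_le_sum fun j _ =>
          hk.integral_norm_le (ham j).aestronglyMeasurable hM (haM j)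
      _ = A := by simp [A]
  have hsupp : ∀ ξ, R < ‖ξ‖ → b ξ = 0 := by
    intro ξ hξ
    funext j
    exact Set.indicator_of_notMem (by simpa [s] using hξ) _
  have hsm' := contDiff_synth_of_support b hbi hsupp
  refine ⟨fun x j => synth (fun ξ => b ξ j) x, fun m => (hsm' m).1, fun i hi x => ?_, fun j => ?_⟩
  · refine ((hsm' i).2 i le_rfl x).trans ?_
    rw [mul_pow]
    refine mul_le_mul (pow_le_pow_left₀ hR0 (by linarith) i) (hbn.trans ?_)
      (integral_nonneg fun ξ => norm_nonneg _) (by positivity)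
    calc A ≤ A + 1 := by linarith
      _ = (A + 1) ^ 1 := (pow_one _).symm
      _ ≤ (A + 1) ^ i := pow_le_pow_right₀ (by linarith) hi
  · refine ⟨hδ.le, fun ξ => a j ξ - b ξ j, ?_, ?_, ?_⟩
    · exact (hai j).aestronglyMeasurable.sub ((hai j).indicator hsm).aestronglyMeasurable
    · have hle : ENNReal.ofReal (δ / (M + 1)) * ENNReal.ofReal M ≤ ENNReal.ofReal δ := by
        rw [← ENNReal.ofReal_mul hs.le]
        refine ENNReal.ofReal_le_ofReal ?_
        rw [div_mul_eq_mul_div, div_le_iff₀ (by positivity)]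
        nlinarith
      refine le_trans ?_ ((mul_le_mul_right (haM j) _).trans hle)
      refine eLpNorm_le_mul_eLpNorm_of_ae_le_mul (Eventually.of_forall fun ξ => ?_) 2
      by_cases hξ : ξ ∈ s
      · simp only [b, Set.indicator_of_mem hξ, sub_self, mul_zero, norm_zero]
        positivity
      · simp only [b, Set.indicator_of_notMem hξ, sub_zero, norm_mul, Complex.norm_real,
          Real.norm_of_nonneg (hk.pos ξ).le, Real.norm_of_nonneg (hk'.pos ξ).le, ← mul_assoc]
        exact mul_le_mul_of_nonneg_right (hR ξ (by simpa [s] using hξ)) (norm_nonneg _)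
    · funext x
      rw [congrFun (hah j) x]
      simp only [synth, mul_sub]
      exact (integral_sub (integrable_expI_mul (hai j) x)
        (integrable_expI_mul ((hai j).indicator hsm) x)).symm

/-- There is a test function that is equal to `1` on the support of a given one. -/
theorem exists_test_eq_one (χ : Test n) : ∃ χ₁ : Test n, ∀ x, χ x ≠ 0 → χ₁ x = 1 := by
  obtain ⟨ρ, hρ, hsub⟩ := χ.hasCompactSupport.isCompact.isBounded.subset_closedBall_lt 0 (0 : Sp n)
  let B : ContDiffBump (0 : Sp n) := ⟨ρ, ρ + 1, hρ, by linarith⟩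
  refine ⟨{ toFun := fun x => (B x : ℂ)
            contDiff' := Complex.ofRealCLM.contDiff.comp B.contDiff
            hasCompactSupport' := B.hasCompactSupport.comp_left Complex.ofReal_zero
            tsupport_subset' := fun _ _ => trivial }, fun x hx => ?_⟩
  change (B x : ℂ) = 1
  rw [B.one_of_mem_closedBall (hsub (subset_tsupport _ hx)), Complex.ofReal_one]

theorem exists_test_ne_zero (n : ℕ) : ∃ χ : Test n, χ ≠ 0 := by
  let B : ContDiffBump (0 : Sp n) := ⟨1, 2, one_pos, one_lt_two⟩
  refine ⟨{ toFun := fun x => (B x : ℂ)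
            contDiff' := Complex.ofRealCLM.contDiff.comp B.contDiff
            hasCompactSupport' := B.hasCompactSupport.comp_left Complex.ofReal_zero
            tsupport_subset' := fun _ _ => trivial }, fun h => ?_⟩
  have h1 : (B 0 : ℂ) = 0 := DFunLike.congr_fun h (0 : Sp n)
  rw [B.one_of_mem_closedBall (Metric.mem_closedBall_self B.rIn_pos.le), Complex.ofReal_one] at h1
  exact one_ne_zero h1

/-- The local estimates for compositions with a holomorphic function. -/
theorem exists_rep_comp {d : ℕ} {Ω : Set (Fin d → ℂ)} (hΩ : IsOpen Ω) {Φ : (Fin d → ℂ) → ℂ}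
    (hΦ : DifferentiableOn ℂ Φ Ω) {k k' : Sp n → ℝ} (hk : IsL2Weight k) (hk' : IsL2Weight k')
    (hpol' : IsKpol k') {K : ℝ} (hK : 0 < K)
    (hmul : ∀ (f g : Sp n → ℂ) (M N : ℝ), FourierRep k' f M → FourierRep k' g N →
      FourierRep k' (fun x => f x * g x) (K * M * N))
    (hlim : Tendsto (fun ξ => k' ξ / k ξ) (cocompact (Sp n)) (𝓝 0))
    {f : Sp n → Fin d → ℂ} (hfc : IsCompact (closure (Set.range f)))
    (hfΩ : closure (Set.range f) ⊆ Ω)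
    (hf : ∀ χ : Test n, ∃ M : ℝ, 0 ≤ M ∧ ∀ y j, FourierRep k (fun x => χ (x - y) * f x j) M)
    (χ : Test n) :
    ∃ (χ₁ : Test n) (δ C : ℝ), 0 < δ ∧ 0 ≤ C ∧ ∀ (g g' : Sp n → Fin d → ℂ) (η : ℝ), 0 ≤ η →
      (∀ y j, FourierRep k' (fun x => χ₁ (x - y) * (g x j - f x j)) δ) →
      (∀ y j, FourierRep k' (fun x => χ₁ (x - y) * (g' x j - f x j)) δ) →
      (∀ y j, FourierRep k' (fun x => χ₁ (x - y) * (g x j - g' x j)) η) →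
      ∀ y, FourierRep k' (fun x => χ (x - y) * Φ (g x)) C ∧
        FourierRep k' (fun x => χ (x - y) * (Φ (g x) - Φ (g' x))) (C * η) := by
  obtain ⟨χ₁, hχ₁⟩ := exists_test_eq_one χ
  obtain ⟨M, hM, hfM⟩ := hf χ₁
  obtain ⟨r, hr, G, hG, hGc, hGΦ⟩ := exists_smooth_compactSupport_eq hΩ hΦ hfc hfΩ
  let L : ℝ := invNorm k'
  have hL : 0 ≤ L := invNorm_nonneg k'
  -- The remainder h will have norm at most 2δ: δ from g - f and δ from the truncation. The first
  -- inequality makes the Neumann series converge in the algebra; the second keeps h at most r/2 in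
  -- sup norm.
  obtain ⟨δ, hδ, hKδ, hLδ⟩ : ∃ δ > 0, K * (r⁻¹ * (2 * δ)) ≤ 1 / 2 ∧ L * (2 * δ) ≤ r / 2 := by
    refine ⟨r / (4 * (K + L)), by positivity, ?_, ?_⟩
    · have : K / (K + L) ≤ 1 := (div_le_one (by positivity)).2 (by linarith)
      calc K * (r⁻¹ * (2 * (r / (4 * (K + L))))) = 1 / 2 * (K / (K + L)) := by field_simp; norm_num
        _ ≤ 1 / 2 := by linarith
    · have : L / (K + L) ≤ 1 := (div_le_one (by positivity)).2 (by linarith)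
      calc L * (2 * (r / (4 * (K + L)))) = r / 2 * (L / (K + L)) := by field_simp; norm_num
        _ ≤ r / 2 := mul_le_of_le_one_right (by positivity) this
  obtain ⟨D, hD, htr⟩ := exists_truncation hk hk' hlim d hM hδ
  obtain ⟨m, M₀, hM₀, hrep⟩ := exists_rep_test_mul_comp hpol' χ hG hGc hD
  let Q : Set (Fin d → ℝ) := Set.Icc 0 fun _ => 2 * Real.pi
  let cd : ℂ := ((2 * Real.pi : ℂ) ^ d)⁻¹
  let V : ℝ := ∫ _θ : Fin d → ℝ in Q, ‖cd‖
  have hV : 0 ≤ V := integral_nonneg fun _ => norm_nonneg _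
  let C₁ : ℝ := V * (2 ^ d * M₀)
  -- The telescoping bound with d factors and difference r⁻¹ η, divided by η and averaged over the
  -- torus.
  let C₂ : ℝ := V * (2 * d * 2 ^ d * (K * M₀ * r⁻¹))
  have hC₁ : 0 ≤ C₁ := by positivity
  have hC₂ : 0 ≤ C₂ := by positivity
  refine ⟨χ₁, δ, C₁ + C₂, hδ, by positivity, fun g g' η hη hg hg' hgg' y => ?_⟩
  -- The centre v depends on f and y but not on g or g', so both compositions are expanded about the
  -- same polydisc.
  obtain ⟨v, hv, hvD, hvδ⟩ := htr (fun x j => χ₁ (x - y) * f x j) (hfM y)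
  let e : (Fin d → ℝ) → Sp n → ℂ := fun θ x =>
    χ (x - y) * G (v x + torusMap 0 (fun _ => r) θ)
  have he : ∀ θ, FourierRep k' (e θ) M₀ := fun θ =>
    hrep y _ v (hv m) fun i h1 _ x => hvD i h1 x
  let ph : (Fin d → ℝ) → Fin d → ℂ := fun θ j => (r * Complex.exp (θ j * Complex.I))⁻¹
  have hph : ∀ θ j, ‖ph θ j‖ = r⁻¹ := by
    intro θ j
    simp only [ph]
    rw [norm_inv, norm_mul, Complex.norm_exp_ofReal_mul_I, mul_one, Complex.norm_real,
      Real.norm_of_nonneg hr.le]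
  let w : (Sp n → Fin d → ℂ) → (Fin d → ℝ) → Fin d → Sp n → ℂ := fun g θ j x =>
    ph θ j * (χ₁ (x - y) * g x j - v x j)
  have hdiff : ∀ g : Sp n → Fin d → ℂ,
      (∀ y j, FourierRep k' (fun x => χ₁ (x - y) * (g x j - f x j)) δ) →
      ∀ j, FourierRep k' (fun x => χ₁ (x - y) * g x j - v x j) (2 * δ) := by
    intro g hg j
    have := (hg y j).add hk' (hvδ j)
    rw [← two_mul] at this
    convert this using 2
    ring
  have hw : ∀ g : Sp n → Fin d → ℂ,
      (∀ y j, FourierRep k' (fun x => χ₁ (x - y) * (g x j - f x j)) δ) →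
      ∀ θ j, FourierRep k' (w g θ j) (r⁻¹ * (2 * δ)) := by
    intro g hg θ j
    have := (hdiff g hg j).const_mul (ph θ j)
    rwa [hph] at this
  have hsup : ∀ g : Sp n → Fin d → ℂ,
      (∀ y j, FourierRep k' (fun x => χ₁ (x - y) * (g x j - f x j)) δ) →
      ∀ j x, ‖χ₁ (x - y) * g x j - v x j‖ ≤ r / 2 := fun g hg j x =>
    ((hdiff g hg j).norm_le hk' x).trans hLδ
  have hw1 : ∀ g : Sp n → Fin d → ℂ,
      (∀ y j, FourierRep k' (fun x => χ₁ (x - y) * (g x j - f x j)) δ) →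
      ∀ θ j x, ‖w g θ j x‖ < 1 := by
    intro g hg θ j x
    simp only [w]
    rw [norm_mul, hph]
    calc r⁻¹ * ‖χ₁ (x - y) * g x j - v x j‖ ≤ r⁻¹ * (r / 2) := by
          gcongr
          exact hsup g hg j x
      _ < 1 := by
          rw [inv_mul_eq_div, div_right_comm, div_self hr.ne']
          norm_num
  have hwθ : ∀ g j x, Continuous fun θ => w g θ j x := by
    intro g j x
    refine Continuous.mul (Continuous.inv₀ (by fun_prop) fun θ => ?_) continuous_const
    exact mul_ne_zero (by exact_mod_cast hr.ne') (Complex.exp_ne_zero _)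
  have hinv : ∀ g : Sp n → Fin d → ℂ,
      (∀ y j, FourierRep k' (fun x => χ₁ (x - y) * (g x j - f x j)) δ) →
      ∀ x, Continuous fun θ => ∏ j, (1 - w g θ j x)⁻¹ := by
    intro g hg x
    refine continuous_finsetProd _ fun j _ => ?_
    refine Continuous.inv₀ (continuous_const.sub (hwθ g j x)) fun θ h0 => ?_
    have h1 := hw1 g hg θ j x
    rw [sub_eq_zero] at h0
    rw [← h0, norm_one] at h1
    exact lt_irrefl _ h1
  have heθ : ∀ x, Continuous fun θ => e θ x := by
    intro x
    refine continuous_const.mul ((hG 0).continuous.comp ?_)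
    refine continuous_const.add ?_
    unfold torusMap
    fun_prop
  have hcauchy : ∀ g : Sp n → Fin d → ℂ,
      (∀ y j, FourierRep k' (fun x => χ₁ (x - y) * (g x j - f x j)) δ) →
      ∀ x, χ (x - y) * Φ (g x) = ∫ θ in Q, cd * (e θ x * ∏ j, (1 - w g θ j x)⁻¹) := by
    intro g hg x
    by_cases hx : χ (x - y) = 0
    · simp [e, hx]
    have hone := hχ₁ _ hx
    have hgv : g x = v x + fun j => χ₁ (x - y) * g x j - v x j := by
      funext j
      simp [hone]
    -- The sup bound with g = f. It places the polydisc of radius r about v(x) within 2r of f(x),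
    -- where G = Φ.
    have hvf : dist (v x) (f x) ≤ r / 2 := by
      rw [dist_pi_le_iff (by positivity)]
      intro j
      have h0 : ∀ y j, FourierRep k' (fun x => χ₁ (x - y) * (f x j - f x j)) δ := fun y j => by
        simpa using (FourierRep.zero k').mono hδ.le
      have := hsup f h0 j x
      rwa [hone, one_mul, ← dist_eq_norm, dist_comm] at this
    have hmem : ∀ z ∈ Metric.closedBall (v x) r, z ∈ Ω ∧ G z = Φ z := by
      intro z hz
      refine hGΦ (f x) (subset_closure ⟨x, rfl⟩) z ?_
      calc dist z (f x) ≤ dist z (v x) + dist (v x) (f x) := dist_triangle _ _ _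
        _ ≤ r + r / 2 := add_le_add hz hvf
        _ ≤ 2 * r := by linarith
    conv_lhs => rw [hgv]
    rw [cauchy_polydisc hr (v x) _ (fun j => (hsup g hg j x).trans_lt (by linarith)) Φ
      (hΦ.mono fun z hz => (hmem z hz).1), ← integral_const_mul]
    refine integral_congr_ae (Eventually.of_forall fun θ => ?_)
    have h1 : v x + torusMap 0 (fun _ => r) θ = torusMap (v x) (fun _ => r) θ := by
      rw [← torusMap_sub_center (v x)]; abel
    have h2 : torusMap (v x) (fun _ => r) θ ∈ Metric.closedBall (v x) r := by
      rw [Metric.mem_closedBall, dist_pi_le_iff hr.le]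
      intro j
      simp [torusMap, dist_eq_norm, Complex.norm_exp_ofReal_mul_I, abs_of_pos hr]
    simp only [e, w, ph, cd]
    rw [h1, (hmem _ h2).2]
    ring
  constructor
  · have h1 := FourierRep.integral hk' (μ := volume.restrict Q) (M := fun _ => ‖cd‖ * (2 ^ d * M₀))
      (F := fun θ x => cd * (e θ x * ∏ j, (1 - w g θ j x)⁻¹)) (fun θ => ?_) ?_ (fun x => ?_)
    · rw [integral_mul_const] at h1
      have h2 : (fun x => χ (x - y) * Φ (g x)) = _ := funext (hcauchy g hg)
      rw [h2]
      exact h1.mono (le_add_of_nonneg_right hC₂)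
    · have := ((he θ).mul_prod_inv_one_sub hk' hK.le hmul (hw g hg θ) hKδ (hw1 g hg θ)
        Finset.univ).const_mul cd
      simpa using this
    · exact continuous_const.integrableOn_Icc
    · exact (continuous_const.mul ((heθ x).mul (hinv g hg x))).integrableOn_Icc
  · have hη' : ∀ θ j, FourierRep k' (fun x => w g θ j x - w g' θ j x) (r⁻¹ * η) := by
      intro θ j
      have := (hgg' y j).const_mul (ph θ j)
      rw [hph] at this
      convert this using 2
      simp only [w]
      ring
    have h1 := FourierRep.integral hk' (μ := volume.restrict Q)
      (M := fun _ => ‖cd‖ * (2 * d * 2 ^ d * (K * M₀ * (r⁻¹ * η))))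
      (F := fun θ x => cd * (e θ x * (∏ j, (1 - w g θ j x)⁻¹ - ∏ j, (1 - w g' θ j x)⁻¹)))
      (fun θ => ?_) ?_ (fun x => ?_)
    · rw [integral_mul_const] at h1
      have h2 : (fun x => χ (x - y) * (Φ (g x) - Φ (g' x))) = fun x => ∫ θ in Q,
          cd * (e θ x * (∏ j, (1 - w g θ j x)⁻¹ - ∏ j, (1 - w g' θ j x)⁻¹)) := by
        funext x
        rw [mul_sub, hcauchy g hg, hcauchy g' hg', ← integral_sub]
        · congr 1
          funext θ
          ring
        · exact (continuous_const.mul ((heθ x).mul (hinv g hg x))).integrableOn_Icc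
        · exact (continuous_const.mul ((heθ x).mul (hinv g' hg' x))).integrableOn_Icc
      rw [h2]
      refine h1.mono ?_
      calc _ = C₂ * η := by simp only [C₂, V]; ring
        _ ≤ (C₁ + C₂) * η := by
          gcongr
          exact le_add_of_nonneg_left hC₁
    · have := ((he θ).mul_prod_inv_one_sub_sub hk' hK.le hmul (hw g hg θ) (hw g' hg' θ) hKδ
        (hw1 g hg θ) (hw1 g' hg' θ) (hη' θ) Finset.univ).const_mul cd
      simpa using this
    · exact continuous_const.integrableOn_Icc
    · exact (continuous_const.mul ((heθ x).mul
        ((hinv g hg x).sub (hinv g' hg' x)))).integrableOn_Icc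

/-! ### Global consequences -/

/-- Outside a large ball the quotient is below 1. Inside it, comparison with the value at 0 bounds
k' above and k below, as continuity of the weights is not assumed. The result transfers 1/k' ∈ L² to
1/k ∈ L². -/
theorem exists_le_mul_of_tendsto {k k' : Sp n → ℝ} (hk : IsKpol k) (hk' : IsKpol k')
    (hlim : Tendsto (fun ξ => k' ξ / k ξ) (cocompact (Sp n)) (𝓝 0)) :
    ∃ c : ℝ, 0 ≤ c ∧ ∀ ξ, k' ξ ≤ c * k ξ := by
  obtain ⟨-, hpos, C, N, hC, hN, hle⟩ := hk
  obtain ⟨-, hpos', C', N', hC', hN', hle'⟩ := hk'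
  obtain ⟨R, hR⟩ := Metric.closedBall_compl_subset_of_mem_cocompact
    (hlim.eventually (gt_mem_nhds one_pos)) (0 : Sp n)
  have hb : ∀ (ξ : Sp n) (P : ℝ), 0 < P → ‖ξ‖ ≤ R → bracket ξ ^ P ≤ (1 + |R|) ^ P := by
    intro ξ P hP hξ
    refine Real.rpow_le_rpow (zero_le_one.trans (one_le_bracket ξ)) ((bracket_le ξ).trans ?_) hP.le
    linarith [le_abs_self R]
  let c₁ : ℝ := C' * (1 + |R|) ^ N' * k' 0 * (C * (1 + |R|) ^ N / k 0)
  have h0 := hpos 0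
  have h0' := hpos' 0
  have hc₁ : 0 ≤ c₁ := by positivity
  refine ⟨c₁ + 1, by positivity, fun ξ => ?_⟩
  have hξpos := hpos ξ
  by_cases hξ : ‖ξ‖ ≤ R
  · have h1 : k' ξ ≤ C' * (1 + |R|) ^ N' * k' 0 := by
      have := hle' ξ 0
      rw [add_zero] at this
      refine this.trans ?_
      have := hb ξ N' hN' hξ
      gcongr ?_ * _
      exact mul_le_mul_of_nonneg_left this hC'.le
    have h2 : 1 ≤ C * (1 + |R|) ^ N / k 0 * k ξ := by
      have := hle (-ξ) ξ
      rw [neg_add_cancel] at this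
      rw [div_mul_eq_mul_div, one_le_div h0]
      refine this.trans ?_
      have := hb (-ξ) N hN (by simpa using hξ)
      gcongr ?_ * _
      exact mul_le_mul_of_nonneg_left this hC.le
    calc k' ξ ≤ C' * (1 + |R|) ^ N' * k' 0 * 1 := by rwa [mul_one]
      _ ≤ C' * (1 + |R|) ^ N' * k' 0 * (C * (1 + |R|) ^ N / k 0 * k ξ) := by gcongr
      _ = c₁ * k ξ := by simp only [c₁]; ring
      _ ≤ (c₁ + 1) * k ξ := by gcongr; linarith
  · have h1 : k' ξ / k ξ < 1 := hR (by simpa using hξ)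
    rw [div_lt_one hξpos] at h1
    nlinarith

/-- Use the window translated so that x sits where χ takes the value χ(x₀), and divide the sup bound
by it. -/
theorem norm_le_of_rep_window {k : Sp n → ℝ} (hk : IsL2Weight k) {χ : Test n} {x₀ : Sp n}
    (hx₀ : χ x₀ ≠ 0) {h : Sp n → ℂ} {M : ℝ} (hM : ∀ y, FourierRep k (fun x => χ (x - y) * h x) M)
    (x : Sp n) : ‖h x‖ ≤ invNorm k * M / ‖χ x₀‖ := by
  have := (hM (x - x₀)).norm_le hk x
  rw [sub_sub_cancel, norm_mul] at this
  rw [le_div_iff₀ (norm_pos_iff.2 hx₀), mul_comm]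
  exact this

/-- The components may be finite for different windows; passing to one common window gives a common
bound. -/
theorem exists_rep_of_memBInf {k : Sp n → ℝ} (hk : IsL2Weight k) (hpol : IsKpol k) {d : ℕ}
    {u : Fin d → Distr n} {f : Sp n → Fin d → ℂ} (hu : ∀ j, MemBInf k (u j))
    (hf : IsContRep u f) (χ : Test n) :
    ∃ M : ℝ, 0 ≤ M ∧ ∀ y j, FourierRep k (fun x => χ (x - y) * f x j) M := by
  have h1 : ∀ j, ∃ M : ℝ, 0 ≤ M ∧ ∀ y, FourierRep k (fun x => χ (x - y) * f x j) M := by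
    intro j
    obtain ⟨χ₁, hχ₁, hfin⟩ := hu j
    obtain ⟨C, hC, hwin⟩ := exists_rep_window hk hpol hχ₁ χ
    rw [hf.2 j] at hfin
    have hlt : ulNorm k χ₁ (ofFun fun x => f x j) <
        ENNReal.ofReal ((ulNorm k χ₁ (ofFun fun x => f x j)).toReal + 1) := by
      rw [ENNReal.ofReal_add ENNReal.toReal_nonneg zero_le_one, ENNReal.ofReal_toReal hfin.ne]
      simpa using ENNReal.lt_add_right hfin.ne one_ne_zero
    have hr := rep_of_ulNorm_lt hk ((continuous_apply j).comp hf.1) (by positivity) hlt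
    exact ⟨_, (hwin _ _ hr 0).nonneg, hwin _ _ hr⟩
  choose M hM0 hM using h1
  refine ⟨∑ j, M j, Finset.sum_nonneg fun j _ => hM0 j, fun y j => (hM j y).mono ?_⟩
  exact Finset.single_le_sum (f := M) (fun j _ => hM0 j) (Finset.mem_univ j)

/-- The uniform local bounds give a sup bound. Compactness then provides the positive distance from
the range to the complement of Ω. -/
theorem isCompact_closure_range_of_rep {k : Sp n → ℝ} (hk : IsL2Weight k) {d : ℕ}
    {f : Sp n → Fin d → ℂ}
    (hf : ∀ χ : Test n, ∃ M : ℝ, 0 ≤ M ∧ ∀ y j, FourierRep k (fun x => χ (x - y) * f x j) M) :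
    IsCompact (closure (Set.range f)) := by
  obtain ⟨χ, hχ⟩ := exists_test_ne_zero n
  obtain ⟨x₀, hx₀⟩ := exists_apply_ne_zero hχ
  obtain ⟨M, hM0, hM⟩ := hf χ
  refine Metric.isCompact_of_isClosed_isBounded isClosed_closure (Bornology.IsBounded.closure ?_)
  refine isBounded_iff_forall_norm_le.2 ⟨invNorm k * M / ‖χ x₀‖, ?_⟩
  rintro _ ⟨x, rfl⟩
  have := invNorm_nonneg k
  exact (pi_norm_le_iff_of_nonneg (by positivity)).2 fun j =>
    norm_le_of_rep_window hk hx₀ (fun y => hM y j) x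

/-- Convergence for one window implies convergence for all of them. -/
theorem eventually_rep_of_tendsto_ulNorm {k : Sp n → ℝ} (hk : IsL2Weight k) (hpol : IsKpol k)
    {χ : Test n} (hχ : χ ≠ 0) {ι : Type*} {l : Filter ι} {d : ℕ} {h : ι → Sp n → Fin d → ℂ}
    (hc : ∀ᶠ i in l, Continuous (h i))
    (hlim : ∀ j, Tendsto (fun i => ulNorm k χ (ofFun fun x => h i x j)) l (𝓝 0))
    (χ₁ : Test n) {δ : ℝ} (hδ : 0 < δ) :
    ∀ᶠ i in l, ∀ y j, FourierRep k (fun x => χ₁ (x - y) * h i x j) δ := by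
  obtain ⟨C, hC, hwin⟩ := exists_rep_window hk hpol hχ χ₁
  let M : ℝ := (2 * Real.pi) ^ n * (δ / (C + 1))
  have hM : 0 < M := by positivity
  have hlt : ∀ᶠ i in l, ∀ j, ulNorm k χ (ofFun fun x => h i x j) < ENNReal.ofReal M :=
    eventually_all.2 fun j => (hlim j).eventually (gt_mem_nhds (ENNReal.ofReal_pos.2 hM))
  filter_upwards [hc, hlt] with i hci hi y j
  have hr := rep_of_ulNorm_lt hk ((continuous_apply j).comp hci) hM.le (hi j)
  refine (hwin _ _ hr y).mono ?_
  simp only [M]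
  rw [inv_mul_cancel_left₀ (by positivity), ← mul_div_assoc, div_le_iff₀ (by positivity)]
  nlinarith

end WienerLevy

end

/-! ### The Wiener–Lévy theorem -/

/-- Part 1 makes the statement meaningful: a tuple in `(ℬ_k^∞)^d` is given by exactly one
continuous function `f : ℝⁿ → ℂ^d`, and `u(ℝⁿ)`, `Φ(u)` are `f(ℝⁿ)`, `Φ ∘ f`. Parts 2 and 3 are
the assertions (a) and (b). Convergence in `ℬ_{k'}^∞` is convergence in a norm `‖·‖_{k',∞,χ}`;
it is assumed for one nonzero `χ` and concluded for all of them. -/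
theorem mainTheorem2 {n d : ℕ} (Ω : Set (Fin d → ℂ)) (hΩ : IsOpen Ω)
    (Φ : (Fin d → ℂ) → ℂ) (hΦ : DifferentiableOn ℂ Φ Ω)
    (k k' : Sp n → ℝ) (hk : IsKpol k) (hk' : IsKa k')
    (hlim : Tendsto (fun ξ => k' ξ / k ξ) (cocompact (Sp n)) (𝓝 0))
    (hL2 : MemLp (fun ξ => 1 / k' ξ) 2 volume) :
    (∀ u : Fin d → Distr n, (∀ j, MemBInf k (u j)) → ∃! f, IsContRep u f) ∧
    (∀ (u : Fin d → Distr n) (f : Sp n → Fin d → ℂ),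
      (∀ j, MemBInf k (u j)) → IsContRep u f → closure (Set.range f) ⊆ Ω →
      MemBInf k' (ofFun fun x => Φ (f x))) ∧
    (∀ (u : Fin d → Distr n) (f : Sp n → Fin d → ℂ)
      (uε : ℝ → Fin d → Distr n) (fε : ℝ → Sp n → Fin d → ℂ) (χ : Test n),
      (∀ j, MemBInf k (u j)) → IsContRep u f →
      (∀ ε ∈ Set.Ioc (0 : ℝ) 1, (∀ j, MemBInf k (uε ε j)) ∧ IsContRep (uε ε) (fε ε)) →
      closure (Set.range f) ⊆ Ω → χ ≠ 0 →
      (∀ j, Tendsto (fun ε => ulNorm k' χ (uε ε j - u j)) (𝓝[>] 0) (𝓝 0)) →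
      ∃ ε₀ ∈ Set.Ioc (0 : ℝ) 1,
        (∀ ε ∈ Set.Ioc 0 ε₀, closure (Set.range (fε ε)) ⊆ Ω ∧
          MemBInf k' (ofFun fun x => Φ (fε ε x))) ∧
        ∀ χ' : Test n, χ' ≠ 0 →
          Tendsto (fun ε => ulNorm k' χ'
            ((ofFun fun x => Φ (fε ε x)) - ofFun fun x => Φ (f x))) (𝓝[>] 0) (𝓝 0)) := by
  have hWk' : IsL2Weight k' := ⟨hk'.1.1, hk'.1.2.1, hL2⟩
  obtain ⟨c, hc, hkc⟩ := exists_le_mul_of_tendsto hk hk'.1 hlim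
  have hWk : IsL2Weight k := by
    refine ⟨hk.1, hk.2.1, hL2.of_le_mul (c := c) ?_ (Eventually.of_forall fun ξ => ?_)⟩
    · exact (measurable_const.div hk.1).aestronglyMeasurable
    · have h1 := hk.2.1 ξ
      have h2 := hk'.1.2.1 ξ
      rw [Real.norm_of_nonneg (by positivity), Real.norm_of_nonneg (by positivity),
        mul_one_div, div_le_div_iff₀ h1 h2, one_mul]
      exact hkc ξ
  obtain ⟨K, hK, hconv⟩ := hk'.2
  have hmul : ∀ (f g : Sp n → ℂ) (M N : ℝ), FourierRep k' f M → FourierRep k' g N →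
      FourierRep k' (fun x => f x * g x) (K * M * N) := fun f g M N hf hg =>
    hf.mul hWk' hK hconv hg
  have hcont : ∀ g : Sp n → Fin d → ℂ, Continuous g → closure (Set.range g) ⊆ Ω →
      Continuous fun x => Φ (g x) := fun g hg hgΩ =>
    hΦ.continuousOn.comp_continuous hg fun x => hgΩ (subset_closure ⟨x, rfl⟩)
  have hzero : ∀ (χ : Test n) (g : Sp n → Fin d → ℂ) (δ : ℝ), 0 ≤ δ → ∀ y j,
      FourierRep k' (fun x => χ (x - y) * (g x j - g x j)) δ := fun χ g δ hδ y j => by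
    simpa using (FourierRep.zero k').mono hδ
  have hcomp := fun (u : Fin d → Distr n) (f : Sp n → Fin d → ℂ) (hu : ∀ j, MemBInf k (u j))
      (hf : IsContRep u f) (hfΩ : closure (Set.range f) ⊆ Ω) =>
    exists_rep_comp hΩ hΦ hWk hWk' hk'.1 hK hmul hlim
      (isCompact_closure_range_of_rep hWk (exists_rep_of_memBInf hWk hk hu hf)) hfΩ
      (exists_rep_of_memBInf hWk hk hu hf)
  have hmem : ∀ (u : Fin d → Distr n) (f : Sp n → Fin d → ℂ),
      (∀ j, MemBInf k (u j)) → IsContRep u f → closure (Set.range f) ⊆ Ω →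
      MemBInf k' (ofFun fun x => Φ (f x)) := by
    intro u f hu hf hfΩ
    obtain ⟨χ, hχ⟩ := exists_test_ne_zero n
    obtain ⟨χ₁, δ, C, hδ, hC, hest⟩ := hcomp u f hu hf hfΩ χ
    refine ⟨χ, hχ, lt_of_le_of_lt (ulNorm_le_of_rep hWk' (hcont f hf.1 hfΩ) (M := C) fun y => ?_)
      ENNReal.ofReal_lt_top⟩
    -- Assertion (a) is the estimate with g = g' = f, where all three differences vanish.
    exact (hest f f 0 le_rfl (hzero χ₁ f δ hδ.le) (hzero χ₁ f δ hδ.le) (hzero χ₁ f 0 le_rfl) y).1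
  refine ⟨fun u hu => ?_, hmem, ?_⟩
  · choose f hfc hfu using fun j => exists_continuous_eq_ofFun hWk (hu j)
    refine ⟨fun x j => f j x, ⟨continuous_pi hfc, hfu⟩, fun g hg => ?_⟩
    funext x j
    have hgc : Continuous fun x => g x j := (continuous_apply j).comp hg.1
    refine congrFun (eq_of_forall_integral_test hgc (hfc j) fun φ => ?_) x
    rw [← ofFun_apply hgc, ← ofFun_apply (hfc j), ← hg.2 j, ← hfu j]
  · intro u f uε fε χ hu hf huε hfΩ hχ htend
    have hcpt : IsCompact (closure (Set.range f)) :=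
      isCompact_closure_range_of_rep hWk (exists_rep_of_memBInf hWk hk hu hf)
    have hIoc : Set.Ioc (0 : ℝ) 1 ∈ 𝓝[>] (0 : ℝ) := Ioc_mem_nhdsGT one_pos
    have hsmall : ∀ (χ₁ : Test n) (δ : ℝ), 0 < δ → ∀ᶠ ε in 𝓝[>] (0 : ℝ), ∀ y j,
        FourierRep k' (fun x => χ₁ (x - y) * (fε ε x j - f x j)) δ := by
      intro χ₁ δ hδ
      refine eventually_rep_of_tendsto_ulNorm (h := fun ε x j => fε ε x j - f x j) hWk' hk'.1 hχ
        ?_ (fun j => ?_) χ₁ hδ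
      · filter_upwards [hIoc] with ε hε
        exact (huε ε hε).2.1.sub hf.1
      · refine (htend j).congr' ?_
        filter_upwards [hIoc] with ε hε
        rw [(huε ε hε).2.2 j, hf.2 j,
          ofFun_sub (f := fun x => fε ε x j) (g := fun x => f x j)
            ((continuous_apply j).comp (huε ε hε).2.1) ((continuous_apply j).comp hf.1)]
    have hclos : ∀ᶠ ε in 𝓝[>] (0 : ℝ), closure (Set.range (fε ε)) ⊆ Ω := by
      obtain ⟨r, hr, hrΩ⟩ := hcpt.exists_cthickening_subset_open hΩ hfΩ
      obtain ⟨x₀, hx₀⟩ := exists_apply_ne_zero hχ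
      have hnx : 0 < ‖χ x₀‖ := norm_pos_iff.2 hx₀
      have hL := invNorm_nonneg k'
      -- With L = `invNorm k'`, this closeness gives a sup distance of at most r L/(L + 1) ≤ r, so
      -- the range of `fε ε` stays in the r-neighbourhood.
      filter_upwards [hsmall χ (r * ‖χ x₀‖ / (invNorm k' + 1)) (by positivity)] with ε hε
      refine (closure_minimal ?_ Metric.isClosed_cthickening).trans hrΩ
      rintro _ ⟨x, rfl⟩
      refine Metric.mem_cthickening_of_dist_le _ (f x) r _ (subset_closure ⟨x, rfl⟩) ?_
      rw [dist_pi_le_iff hr.le]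
      intro j
      rw [dist_eq_norm]
      refine (norm_le_of_rep_window (h := fun x => fε ε x j - f x j) hWk' hx₀
        (fun y => hε y j) x).trans ?_
      rw [div_le_iff₀ hnx, ← mul_div_assoc, div_le_iff₀ (by positivity)]
      nlinarith [mul_pos hr hnx]
    obtain ⟨a, ha, hsub⟩ := mem_nhdsGT_iff_exists_Ioc_subset.1 hclos
    refine ⟨min a 1, ⟨lt_min ha one_pos, min_le_right _ _⟩, fun ε hε => ?_, fun χ' hχ' => ?_⟩
    · have h1 : closure (Set.range (fε ε)) ⊆ Ω := hsub ⟨hε.1, hε.2.trans (min_le_left _ _)⟩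
      have h2 := huε ε ⟨hε.1, hε.2.trans (min_le_right _ _)⟩
      exact ⟨h1, hmem _ _ h2.1 h2.2 h1⟩
    · obtain ⟨χ₁, δ, C, hδ, hC, hest⟩ := hcomp u f hu hf hfΩ χ'
      refine ENNReal.tendsto_nhds_zero.2 fun τ hτ => ?_
      obtain ⟨t, ht, htτ⟩ := ENNReal.lt_iff_exists_nnreal_btwn.1 hτ
      have ht0 : (0 : ℝ) < t := by exact_mod_cast ht
      -- Chosen so that (2π)^n C η ≤ t; using C + 1 avoids division by zero when C = 0.
      have hη : 0 < (t : ℝ) / ((2 * Real.pi) ^ n * (C + 1)) := by positivity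
      filter_upwards [hIoc, hclos, hsmall χ₁ δ hδ, hsmall χ₁ _ hη] with ε hε hεΩ h1 h2
      have hc1 := hcont _ (huε ε hε).2.1 hεΩ
      have hc2 := hcont f hf.1 hfΩ
      rw [ofFun_sub hc1 hc2]
      refine (ulNorm_le_of_rep hWk' (hc1.sub hc2) fun y =>
        (hest (fε ε) f _ hη.le h1 (hzero χ₁ f δ hδ.le) h2 y).2).trans (le_trans ?_ htτ.le)
      rw [← ENNReal.ofReal_coe_nnreal]
      refine ENNReal.ofReal_le_ofReal ?_
      have hp : (0 : ℝ) < (2 * Real.pi) ^ n := by positivity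
      calc (2 * Real.pi) ^ n * (C * ((t : ℝ) / ((2 * Real.pi) ^ n * (C + 1)))) =
          t * (C / (C + 1)) := by field_simp
        _ ≤ t := mul_le_of_le_one_right ht0.le ((div_le_one (by positivity)).2 (by linarith))
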